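/- For $n\ge 0$ let $E_n$ be the Euler number, i.e. the number of permutations $a_1a_2\cdots a_n$ of $\{1,\dots,n\}$ that are alternating, $a_1>a_2<a_3>a_4<\cdots$. For a standard Young tableau (SYT) $T$ with $n$ cells (English convention), let $D(T)$ be the set of those $i\in\{1,\dots,n-1\}$ such that $i+1$ lies in a lower row of $T$ than $i$. Call $T$ alternating if $D(T)=\{1,3,5,\dots\}\cap\{1,\dots,n-1\}$ and reverse alternating if $D(T)=\{2,4,6,\dots\}\cap\{1,\dots,n-1\}$, and let $\mathrm{alt}(\lambda)$ (respectively $\mathrm{ralt}(\lambda)$) be the number of alternating (respectively reverse alternating) SYT of shape $\lambda$. Let $H_\lambda$ be the product of the hook lengths of the cells of $\lambda$. Let $p$ be an odd positive integer and let $p\times p$ denote the partition of $p^2$ whose shape is a $p\times p$ square. Then $$\mathrm{alt}(p\times p)=\mathrm{ralt}(p\times p)=\frac{1}{H_{p\times p}}\,E^p\prod_{j=1}^{p-1}\bigl(E^2+(2j)^2\bigr)^{p-j},$$ where the right-hand side is read umbrally: the product is expanded as a polynomial in the indeterminate $E$, and then each power $E^k$ is replaced by the Euler number $E_k$. -/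

import Mathlib

noncomputable section

namespace AltTableaux

open Polynomial

/-- The descent set `D(w) = {i ∈ [n-1] | w(i) > w(i+1)}` of a permutation of `{1, …, n}`.
Positions and values are modelled by `Fin n`, so the (1-based) positions `i` and `i + 1`
are the elements of `Fin n` with underlying naturals `i - 1` and `i`. -/
def permDescentSet {n : ℕ} (w : Equiv.Perm (Fin n)) : Set ℕ :=
  {i | ∃ a b : Fin n, (a : ℕ) + 1 = i ∧ (b : ℕ) = i ∧ w b < w a}

/-- `w` is alternating: `D(w) = {1, 3, 5, …} ∩ [n-1]`. -/
def IsAlternatingPerm {n : ℕ} (w : Equiv.Perm (Fin n)) : Prop :=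
  permDescentSet w = {i | Odd i} ∩ Set.Icc 1 (n - 1)

/-- The Euler number `E_n`: the number of alternating permutations of `{1, …, n}`. -/
def eulerNumber (n : ℕ) : ℕ :=
  Nat.card {w : Equiv.Perm (Fin n) // IsAlternatingPerm w}

/-- Umbral evaluation of a polynomial in `E` (the variable `X`): the linear
functional that replaces each power `E ^ k` by the Euler number `E_k`. -/
def umbralEval (P : ℚ[X]) : ℚ :=
  P.sum fun k a => a * (eulerNumber k : ℚ)

/-- A semistandard tableau of shape `μ` is standard if each of `1, …, |μ|` occurs in
exactly one cell (the rows are then strictly increasing). -/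
def IsStandard {μ : YoungDiagram} (T : SemistandardYoungTableau μ) : Prop :=
  Set.BijOn (fun c : ℕ × ℕ => T c.1 c.2) (μ.cells : Set (ℕ × ℕ)) (Set.Icc 1 μ.card)

/-- The descent set of a tableau: those `i` such that `i + 1` is in a lower row than `i`
(rows are numbered from top to bottom). -/
def descentSet {μ : YoungDiagram} (T : SemistandardYoungTableau μ) : Set ℕ :=
  {i | ∃ c ∈ μ.cells, ∃ d ∈ μ.cells, T c.1 c.2 = i ∧ T d.1 d.2 = i + 1 ∧ c.1 < d.1}

/-- `D(T) = {1, 3, 5, …} ∩ [n-1]`, where `n = |μ|`. -/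
def IsAlternating {μ : YoungDiagram} (T : SemistandardYoungTableau μ) : Prop :=
  descentSet T = {i | Odd i} ∩ Set.Icc 1 (μ.card - 1)

/-- `D(T) = {2, 4, 6, …} ∩ [n-1]`, where `n = |μ|`. -/
def IsReverseAlternating {μ : YoungDiagram} (T : SemistandardYoungTableau μ) : Prop :=
  descentSet T = {i | Even i} ∩ Set.Icc 1 (μ.card - 1)

/-- A Young diagram has finitely many standard tableaux, so the counts below are genuine. -/
theorem finite_isStandard (μ : YoungDiagram) :
    {T : SemistandardYoungTableau μ | IsStandard T}.Finite := by
  have hinj : Set.InjOn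
      (fun (T : SemistandardYoungTableau μ) (c : μ.cells) => T c.1.1 c.1.2)
      {T | IsStandard T} := by
    intro T _ T' _ h
    ext i j
    by_cases hc : (i, j) ∈ μ
    · exact congrFun h ⟨(i, j), hc⟩
    · rw [T.zeros hc, T'.zeros hc]
  refine Set.Finite.of_finite_image (Set.Finite.subset
    (Set.Finite.pi' (fun _ : μ.cells => Set.finite_Icc 1 μ.card)) ?_) hinj
  rintro _ ⟨T, hT, rfl⟩ c
  exact hT.mapsTo c.2

/-- `alt(μ)`: the number of alternating standard Young tableaux of shape `μ`. -/
def alt (μ : YoungDiagram) : ℕ :=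
  Nat.card {T : SemistandardYoungTableau μ // IsStandard T ∧ IsAlternating T}

/-- `ralt(μ)`: the number of reverse alternating standard Young tableaux of shape `μ`. -/
def ralt (μ : YoungDiagram) : ℕ :=
  Nat.card {T : SemistandardYoungTableau μ // IsStandard T ∧ IsReverseAlternating T}

/-- The hook length of the cell `c = (row, column)`: arm length plus leg length plus one. -/
def hookLength (μ : YoungDiagram) (c : ℕ × ℕ) : ℕ :=
  (μ.rowLen c.1 - (c.2 + 1)) + (μ.colLen c.2 - (c.1 + 1)) + 1

/-- `H_μ`: the product of the hook lengths of all cells of `μ`. -/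
def hookProduct (μ : YoungDiagram) : ℕ :=
  ∏ c ∈ μ.cells, hookLength μ c

/-- The `p × p` square shape. -/
def squareShape (p : ℕ) : YoungDiagram where
  cells := Finset.range p ×ˢ Finset.range p
  isLowerSet := by
    rintro ⟨a, b⟩ ⟨c, d⟩ ⟨h₁, h₂⟩ h
    simp only [Finset.coe_product, Finset.coe_range, Set.mem_prod, Set.mem_Iio] at h ⊢
    exact ⟨lt_of_le_of_lt h₁ h.1, lt_of_le_of_lt h₂ h.2⟩

/-- The polynomial `E^p (E^2 + 2^2)^(p-1) (E^2 + 4^2)^(p-2) ⋯ (E^2 + (2(p-1))^2)` in the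
variable `E = X`. -/
def squarePoly (p : ℕ) : ℚ[X] :=
  X ^ p * ∏ j ∈ Finset.Icc 1 (p - 1), (X ^ 2 + C ((2 * (j : ℚ)) ^ 2)) ^ (p - j)

end AltTableaux

end

namespace AltTableaux

open Polynomial

/-! Write L for `eulerFunctional`, so that formally L(exp(yX)) = tanh(y/2), and F_X(s) =
((1+s)/(1-s))^X. The heart of the proof is `walkTotal_eq_eulerFunctional`: for a shape λ with 2q+1
cells, (-1)^q alt(λ) is the value of L at the Jacobi–Trudi determinant built from the coefficients
of F_X. Both sides satisfy the same recurrence: summed over all μ such that λ/μ is a horizontal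
strip of even size, they give 1 if λ is a single row and 0 otherwise. The term μ = λ occurs with
coefficient one, so the recurrence determines its solution.

For tableaux the recurrence is inclusion–exclusion (`sum_walkTotal`). Tableaux with descents exactly
1, 3, …, 2m-1, together with those with descents exactly 1, 3, …, 2m+1, are the alternating tableaux
with 2m+1 cells followed by a horizontal strip, and the alternating sum over m telescopes. The same
argument for permutations gives tan · cos = sin for the odd Euler numbers, hence L(f(X) + f(X-1)) =
f(0) - f(-1).

For determinants, F_{X-1} = F_X · (1-s)/(1+s), so X ↦ X-1 turns a sum over all exponent vectors
below b = λ+δ into the corresponding signed sum. In the identity for L, the terms of even size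
difference survive on the left, and on the right those of odd size difference, evaluated at X = 0,
where F_0 = 1. Pieri's rule `sum_box_eq_sum_interlaced` reduces both sides to horizontal strips.

For the square, reversing the rows gives a Hankel determinant. The coefficients of F_X are moments
of powers of 2u-1 against the beta weight (u/(1-u))^X, so `det_hankel_cayleyCoeff` evaluates it as a
product over ∏(i+j+1), the hook product. Up to a global sign, L treats (2X)^2 as -E^2, which turns
(2j)^2 - (2X)^2 into E^2 + (2j)^2. Finally, transposition complements descent sets and the square is
self-conjugate, so alt = ralt. -/

/-- The linear functional on `ℚ[X]` with prescribed values on the powers of `X`. -/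
noncomputable def momentFunctional {V : Type*} [AddCommGroup V] [Module ℚ V] (m : ℕ → V) :
    ℚ[X] →ₗ[ℚ] V :=
  Polynomial.lsum fun k => LinearMap.toSpanSingleton ℚ V (m k)

/-! ### Linear functionals given by their moments -/

section MomentFunctional

variable {V : Type*} [AddCommGroup V] [Module ℚ V] (m : ℕ → V)

theorem momentFunctional_apply (P : ℚ[X]) : momentFunctional m P = P.sum fun k a => a • m k := rfl

@[simp]
theorem momentFunctional_monomial (n : ℕ) (c : ℚ) :
    momentFunctional m (monomial n c) = c • m n := by
  rw [momentFunctional_apply, sum_monomial_index _ _ (by simp)]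

@[simp]
theorem momentFunctional_X_pow (n : ℕ) : momentFunctional m (X ^ n) = m n := by
  rw [X_pow_eq_monomial, momentFunctional_monomial, one_smul]

@[simp]
theorem momentFunctional_C_mul_X_pow (c : ℚ) (n : ℕ) :
    momentFunctional m (C c * X ^ n) = c • m n := by
  rw [C_mul_X_pow_eq_monomial, momentFunctional_monomial]

/-- Two linear maps on `ℚ[X]` agree if they agree on the powers of `X`. -/
theorem linearMap_eq_of_X_pow {W : Type*} [AddCommGroup W] [Module ℚ W] {f g : ℚ[X] →ₗ[ℚ] W}
    (h : ∀ n, f (X ^ n) = g (X ^ n)) : f = g := by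
  refine Polynomial.lhom_ext' fun n => LinearMap.ext_ring ?_
  simpa [X_pow_eq_monomial] using h n

end MomentFunctional

/-! ### Hankel determinants of beta moments -/

/-- The determinant of ratios of rising factorials. -/
theorem det_ascPochhammer_ratio (p : ℕ) (α γ : ℚ) (hγ : 0 < γ) :
    (Matrix.of fun i j : Fin p => (ascPochhammer ℚ j).eval (α + i) /
        (ascPochhammer ℚ j).eval (γ + i)).det * ∏ i ∈ Finset.range p, ∏ j ∈ Finset.range (p - 1),
          (γ + i + j) =
      ∏ i ∈ Finset.range p, (i.factorial : ℚ) * (ascPochhammer ℚ i).eval (γ - α) := by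
  induction p generalizing α γ with
  | zero => simp
  | succ p ih =>
    set A : Matrix (Fin (p + 1)) (Fin (p + 1)) ℚ := Matrix.of fun i j =>
      (ascPochhammer ℚ j).eval (α + i) / (ascPochhammer ℚ j).eval (γ + i) with hA
    -- The column `j = 0` consists of ones, so subtracting from each row its predecessor reduces the
    -- determinant to a minor.
    set B : Matrix (Fin (p + 1)) (Fin (p + 1)) ℚ :=
      Matrix.of (Fin.cons (A 0) fun i j => A i.succ j - A i.castSucc j) with hB
    have hdet : A.det = B.det :=
      Matrix.det_eq_of_forall_row_eq_smul_add_pred (fun _ => 1) (fun j => by simp [hB])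
        (fun i j => by simp [hB])
    have hcol : ∀ i : Fin p, B i.succ 0 = 0 := fun i => by simp [hB, hA]
    -- Each difference splits into a row factor, a column factor and an entry of the same matrix
    -- with `α + 1`, `γ + 2` in place of `α`, `γ`; this is what the induction needs.
    have hmin : (B.submatrix (Fin.succAbove 0) Fin.succ) = Matrix.of fun i j : Fin p =>
        ((γ - α) / ((γ + i) * (γ + i + 1))) * (((j : ℚ) + 1) *
          ((ascPochhammer ℚ j).eval (α + 1 + i) / (ascPochhammer ℚ j).eval (γ + 2 + i))) := by
      ext i j
      have e1 : (ascPochhammer ℚ (j + 1)).eval (α + i) =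
          (α + i) * (ascPochhammer ℚ j).eval (α + 1 + i) := by
        rw [ascPochhammer_succ_left]; simp [add_right_comm]
      have e2 : (ascPochhammer ℚ (j + 1)).eval (γ + i) =
          (γ + i) * (ascPochhammer ℚ j).eval (γ + 1 + i) := by
        rw [ascPochhammer_succ_left]; simp [add_right_comm]
      have e3 : (ascPochhammer ℚ (j + 1)).eval (α + (i + 1 : ℕ)) =
          (ascPochhammer ℚ j).eval (α + 1 + i) * (α + 1 + i + j) := by
        rw [ascPochhammer_succ_right]
        simp [add_comm, add_left_comm]
      have e4 : (ascPochhammer ℚ (j + 1)).eval (γ + (i + 1 : ℕ)) =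
          (γ + i + 1) * (ascPochhammer ℚ j).eval (γ + 2 + i) := by
        rw [ascPochhammer_succ_left]
        simp only [eval_mul, eval_X, eval_comp, eval_add, eval_one]
        push_cast
        ring_nf
      have e5 : (γ + i + 1) * (ascPochhammer ℚ j).eval (γ + 2 + i) =
          (ascPochhammer ℚ j).eval (γ + 1 + i) * (γ + i + j + 1) := by
        rw [← e4, ascPochhammer_succ_right]
        simp
        ring_nf
      have h1 : (ascPochhammer ℚ j).eval (γ + 1 + i) ≠ 0 :=
        (ascPochhammer_pos _ _ (by positivity)).ne'
      have h2 : (ascPochhammer ℚ j).eval (γ + 2 + i) ≠ 0 :=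
        (ascPochhammer_pos _ _ (by positivity)).ne'
      have h3 : γ + i ≠ 0 := by positivity
      have h4 : γ + i + 1 ≠ 0 := by positivity
      simp only [hB, hA, Matrix.submatrix_apply, Fin.zero_succAbove, Matrix.of_apply, Fin.cons_succ,
        Fin.val_succ, Fin.val_castSucc]
      rw [e3, e4, e1, e2]
      have h5 : γ + i + j + 1 ≠ 0 := by positivity
      have e6 : (ascPochhammer ℚ j).eval (γ + 1 + i) =
          (γ + i + 1) * (ascPochhammer ℚ j).eval (γ + 2 + i) / (γ + i + j + 1) := by
        rw [e5]; field_simp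
      rw [e6]
      field_simp
      ring
    have hB0 : B 0 0 = 1 := by simp [hB, hA]
    have hdetB : B.det = (∏ i : Fin p, (γ - α) / ((γ + i) * (γ + i + 1))) *
        ((∏ j : Fin p, ((j : ℚ) + 1)) * (Matrix.of fun i j : Fin p =>
          (ascPochhammer ℚ j).eval (α + 1 + i) / (ascPochhammer ℚ j).eval (γ + 2 + i)).det) := by
      rw [Matrix.det_succ_column_zero, Fin.sum_univ_succ]
      simp only [hcol, hB0, hmin]
      rw [← Matrix.det_mul_row, ← Matrix.det_mul_column]
      simp
    have hprod : ∏ i ∈ Finset.range (p + 1), ∏ j ∈ Finset.range p, (γ + i + j) =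
        (∏ i : Fin p, ((γ + i) * (γ + i + 1))) *
          ∏ i ∈ Finset.range p, ∏ j ∈ Finset.range (p - 1), (γ + 2 + i + j) := by
      rw [Finset.prod_comm, ← Finset.prod_range fun i : ℕ => (γ + i) * (γ + i + 1),
        ← Finset.prod_mul_distrib]
      refine Finset.prod_congr rfl fun j hj => ?_
      obtain ⟨q, rfl⟩ : ∃ q, p = q + 1 :=
        ⟨p - 1, by have := Finset.mem_range.1 hj; omega⟩
      rw [Finset.prod_range_succ', Finset.prod_range_succ', Nat.add_sub_cancel, mul_assoc, mul_comm]
      congr 1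
      · push_cast
        ring
      · refine Finset.prod_congr rfl fun i _ => ?_
        push_cast
        ring
    have hne : ∏ i : Fin p, ((γ + i) * (γ + i + 1)) ≠ 0 :=
      Finset.prod_ne_zero_iff.2 fun i _ => by positivity
    have hih := ih (α + 1) (γ + 2) (by positivity)
    have hright : ∏ i ∈ Finset.range (p + 1),
        ((i.factorial : ℚ) * (ascPochhammer ℚ i).eval (γ - α)) =
        (∏ i ∈ Finset.range p, (γ - α)) * ((∏ i ∈ Finset.range p, ((i : ℚ) + 1)) *
          ∏ i ∈ Finset.range p, (i.factorial : ℚ) *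
            (ascPochhammer ℚ i).eval (γ + 2 - (α + 1))) := by
      rw [Finset.prod_range_succ', ← Finset.prod_mul_distrib, ← Finset.prod_mul_distrib]
      simp only [Nat.factorial_zero, Nat.cast_one, ascPochhammer_zero, eval_one, mul_one]
      refine Finset.prod_congr rfl fun i _ => ?_
      rw [ascPochhammer_succ_left, Nat.factorial_succ]
      simp only [eval_mul, eval_X, eval_comp, eval_add, eval_one]
      push_cast
      ring_nf
    rw [Nat.add_sub_cancel, hprod, hdet, hdetB, hright, ← hih, Finset.prod_div_distrib,
      ← Finset.prod_range fun _ => γ - α, ← Finset.prod_range fun i : ℕ => (i : ℚ) + 1]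
    field_simp

/-- Up to normalisation, the `k`-th moment of the beta-type weight `(u / (1 - u)) ^ X`. -/
noncomputable def betaMoment (k : ℕ) : ℚ[X] :=
  C (2 / ((k + 1).factorial : ℚ)) * ascPochhammer ℚ (k + 1)

/-- The coefficient of `s ^ n` in `((1 + s) / (1 - s)) ^ X`, as a polynomial in `X`. -/
noncomputable def cayleyCoeff : ℕ → ℚ[X]
  | 0 => 1
  | n + 1 => momentFunctional betaMoment ((C 2 * X - 1) ^ n)

theorem eval_betaMoment (k : ℕ) (a : ℚ) :
    (betaMoment k).eval a = 2 / ((k + 1).factorial : ℚ) * (ascPochhammer ℚ (k + 1)).eval a := by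
  simp [betaMoment]

theorem eval_cayleyCoeff_succ (n : ℕ) (a : ℚ) :
    (cayleyCoeff (n + 1)).eval a =
      momentFunctional (fun k => (betaMoment k).eval a) ((C 2 * X - 1) ^ n) := by
  have h : (Polynomial.leval a).comp (momentFunctional betaMoment) =
      momentFunctional (fun k => (betaMoment k).eval a) :=
    linearMap_eq_of_X_pow fun n => by simp
  exact LinearMap.congr_fun h _

/-- Splitting the rising factorial of length `i + j + 1` after `i + 1` factors pulls `2 (a)_{i+1} /
(i+1)!` out of row `i`. What remains is the ratio matrix with `α = a + 1`, `γ = 2`, so that `γ - α =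
1 - a`. -/
theorem det_betaMoment_mul (p : ℕ) (a : ℚ) :
    (Matrix.of fun i j : Fin p => (betaMoment (i + j)).eval a).det *
        ∏ i ∈ Finset.range p, ∏ j ∈ Finset.range p, ((i : ℚ) + j + 1) =
      ∏ i ∈ Finset.range p, 2 * ((ascPochhammer ℚ (i + 1)).eval a *
        (ascPochhammer ℚ i).eval (1 - a)) := by
  have hentry : (Matrix.of fun i j : Fin p => (betaMoment (i + j)).eval a) =
      Matrix.of fun i j : Fin p => (2 / ((i : ℕ) + 1).factorial * (ascPochhammer ℚ (i + 1)).eval a) *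
        ((Matrix.of fun i j : Fin p => (ascPochhammer ℚ j).eval (a + 1 + i) /
          (ascPochhammer ℚ j).eval (2 + (i : ℚ))) i j) := by
    ext i j
    have h1 : (ascPochhammer ℚ (i + j + 1)).eval a =
        (ascPochhammer ℚ (i + 1)).eval a * (ascPochhammer ℚ j).eval (a + 1 + i) := by
      rw [add_right_comm, ← ascPochhammer_mul]
      simp [add_comm, add_left_comm]
    have h2 : (((i : ℕ) + j + 1).factorial : ℚ) =
        ((i : ℕ) + 1).factorial * (ascPochhammer ℚ j).eval (2 + (i : ℚ)) := by
      have h := Nat.factorial_mul_ascFactorial (i + 1) j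
      rw [← ascPochhammer_nat_eq_ascFactorial] at h
      have h' := congrArg (Nat.cast : ℕ → ℚ) h
      push_cast at h'
      rw [add_right_comm, ← h']
      ring_nf
    have h3 : (ascPochhammer ℚ j).eval (2 + (i : ℚ)) ≠ 0 :=
      (ascPochhammer_pos _ _ (by positivity)).ne'
    simp only [Matrix.of_apply, eval_betaMoment, h1, h2]
    field_simp
  have hD := det_ascPochhammer_ratio p (a + 1) 2 (by norm_num)
  rw [hentry, Matrix.det_mul_column]
  have hH : ∏ i ∈ Finset.range p, ∏ j ∈ Finset.range p, ((i : ℚ) + j + 1) =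
      (∏ i ∈ Finset.range p, ((i : ℚ) + 1)) *
        ∏ i ∈ Finset.range p, ∏ j ∈ Finset.range (p - 1), (2 + (i : ℚ) + j) := by
    rw [← Finset.prod_mul_distrib]
    refine Finset.prod_congr rfl fun i hi => ?_
    obtain ⟨q, rfl⟩ : ∃ q, p = q + 1 := ⟨p - 1, by have := Finset.mem_range.1 hi; omega⟩
    rw [Finset.prod_range_succ', Nat.add_sub_cancel, mul_comm]
    congr 1
    · simp
    · refine Finset.prod_congr rfl fun j _ => ?_
      push_cast
      ring
  rw [hH, mul_mul_mul_comm, hD, ← Finset.prod_range fun i : ℕ =>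
      2 / ((i + 1).factorial : ℚ) * (ascPochhammer ℚ (i + 1)).eval a,
    ← Finset.prod_mul_distrib, ← Finset.prod_mul_distrib]
  refine Finset.prod_congr rfl fun i _ => ?_
  rw [Nat.factorial_succ, show (2 : ℚ) - (a + 1) = 1 - a by ring]
  have : (i.factorial : ℚ) ≠ 0 := by positivity
  push_cast
  field_simp

/-- Change of basis for Hankel determinants along `X ↦ 2 X - 1`. -/
theorem det_hankel_affine (p : ℕ) (m : ℕ → ℚ) :
    (Matrix.of fun i j : Fin p =>
        momentFunctional m ((C 2 * X - 1) ^ ((i : ℕ) + (j : ℕ)))).det =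
      (∏ i ∈ Finset.range p, (2 : ℚ) ^ i) ^ 2 * (Matrix.of fun i j : Fin p => m (i + j)).det := by
  set y : ℚ[X] := C 2 * X - 1 with hy
  have hdeg : y.natDegree = 1 := by
    rw [hy, ← C_1, sub_eq_add_neg, ← C_neg]
    exact natDegree_linear (by norm_num)
  have hlead : y.leadingCoeff = 2 := by
    rw [leadingCoeff, hdeg, hy]
    simp [coeff_one]
  have hpow : ∀ n, (y ^ n).natDegree = n := fun n => by rw [natDegree_pow, hdeg, mul_one]
  -- The coefficients of the powers of `y` form a triangular matrix with diagonal `2 ^ i`; the new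
  -- Hankel matrix is the congruence of the old one by it.
  set B : Matrix (Fin p) (Fin p) ℚ := Matrix.of fun i k => (y ^ (i : ℕ)).coeff k with hB
  have hBdet : B.det = ∏ i ∈ Finset.range p, (2 : ℚ) ^ i := by
    rw [Matrix.det_of_isLowerTriangular, Finset.prod_range]
    · refine Finset.prod_congr rfl fun i _ => ?_
      have h := leadingCoeff_pow y i
      rw [leadingCoeff, hpow, hlead] at h
      exact h
    · intro i j hij
      exact coeff_eq_zero_of_natDegree_lt ((hpow i).trans_lt hij)
  have hexp : ∀ i : Fin p, y ^ (i : ℕ) = ∑ k : Fin p, C (B i k) * X ^ (k : ℕ) := fun i => by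
    exact (as_sum_range_C_mul_X_pow' (n := p) _ ((hpow i).trans_lt i.2)).trans
      (Finset.sum_range fun k => C ((y ^ (i : ℕ)).coeff k) * X ^ k)
  have hmat : (Matrix.of fun i j : Fin p => momentFunctional m (y ^ ((i : ℕ) + (j : ℕ)))) =
      B * (Matrix.of fun i j : Fin p => m (i + j)) * B.transpose := by
    ext i j
    rw [Matrix.of_apply, pow_add, hexp i, hexp j, Finset.sum_mul_sum, map_sum]
    simp only [Matrix.mul_apply, Matrix.transpose_apply, Matrix.of_apply, Finset.sum_mul]
    simp only [map_sum]
    rw [Finset.sum_comm]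
    refine Finset.sum_congr rfl fun l _ => Finset.sum_congr rfl fun k _ => ?_
    rw [show C (B i k) * X ^ (k : ℕ) * (C (B j l) * X ^ (l : ℕ)) =
      C (B i k * B j l) * X ^ ((k : ℕ) + l) by rw [C_mul, pow_add]; ring,
      momentFunctional_C_mul_X_pow, smul_eq_mul]
    ring
  rw [hmat, Matrix.det_mul, Matrix.det_mul, Matrix.det_transpose, hBdet]
  ring

/-- Pair the factor `a + j` of the first product with the factor `j - a` of the second. -/
theorem ascPochhammer_eval_mul_eval_one_sub (i : ℕ) (a : ℚ) :
    (ascPochhammer ℚ (i + 1)).eval a * (ascPochhammer ℚ i).eval (1 - a) =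
      a * ∏ j ∈ Finset.Icc 1 i, ((j : ℚ) ^ 2 - a ^ 2) := by
  induction i with
  | zero => simp
  | succ i ih =>
    rw [ascPochhammer_succ_eval (i + 1) a, ascPochhammer_succ_eval i (1 - a), Finset.prod_Icc_succ_top (by omega),
      ← mul_assoc a, ← ih]
    push_cast
    ring

theorem prod_prod_Icc_eq_prod_pow (p : ℕ) (f : ℕ → ℚ) :
    ∏ i ∈ Finset.range p, ∏ j ∈ Finset.Icc 1 i, f j =
      ∏ j ∈ Finset.Icc 1 (p - 1), f j ^ (p - j) := by
  induction p with
  | zero => simp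
  | succ p ih =>
    rw [Finset.prod_range_succ, ih, Nat.add_sub_cancel]
    rcases p with _ | p
    · simp
    · rw [Nat.add_sub_cancel, Finset.prod_Icc_succ_top (by omega),
        Finset.prod_Icc_succ_top (by omega), ← mul_assoc, ← Finset.prod_mul_distrib]
      congr 1
      · refine Finset.prod_congr rfl fun j hj => ?_
        rw [Finset.mem_Icc] at hj
        rw [← pow_succ]
        congr 1
        omega
      · simp

/-- The Hankel determinant of the coefficients of `((1 + s) / (1 - s)) ^ X`. -/
theorem det_hankel_cayleyCoeff (p : ℕ) :
    (Matrix.of fun i j : Fin p => cayleyCoeff (i + j + 1)).det *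
        C (∏ i ∈ Finset.range p, ∏ j ∈ Finset.range p, ((i : ℚ) + j + 1)) =
      (C 2 * X) ^ p * ∏ j ∈ Finset.Icc 1 (p - 1),
        (C ((2 * (j : ℚ)) ^ 2) - (C 2 * X) ^ 2) ^ (p - j) := by
  refine Polynomial.funext fun a => ?_
  rw [eval_mul, ← coe_evalRingHom, RingHom.map_det, coe_evalRingHom, eval_C]
  have hmat : (evalRingHom a).mapMatrix
      (Matrix.of fun i j : Fin p => cayleyCoeff (i + j + 1)) = Matrix.of fun i j : Fin p =>
        momentFunctional (fun k => (betaMoment k).eval a) ((C 2 * X - 1) ^ ((i : ℕ) + (j : ℕ))) := by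
    ext i j
    simp [eval_cayleyCoeff_succ]
  rw [hmat, det_hankel_affine, mul_assoc, det_betaMoment_mul]
  simp only [ascPochhammer_eval_mul_eval_one_sub, eval_mul, eval_pow, eval_prod, eval_sub, eval_C,
    eval_X]
  rw [← prod_prod_Icc_eq_prod_pow p fun j => (2 * (j : ℚ)) ^ 2 - (2 * a) ^ 2,
    ← Finset.prod_pow, ← Finset.prod_mul_distrib]
  have : (2 * a) ^ p = ∏ i ∈ Finset.range p, (2 * a) := by simp
  rw [this, ← Finset.prod_mul_distrib]
  refine Finset.prod_congr rfl fun i _ => ?_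
  have : ∀ j : ℕ, (2 * (j : ℚ)) ^ 2 - (2 * a) ^ 2 = 2 ^ 2 * ((j : ℚ) ^ 2 - a ^ 2) :=
    fun j => by ring
  simp only [this, Finset.prod_mul_distrib, Finset.prod_const, Nat.card_Icc, Nat.add_sub_cancel]
  rw [← pow_mul, ← pow_mul, mul_comm i 2]
  ring

/-! ### Permutations with prescribed descents: the Entringer recurrence -/

/-- The pattern of descents at the odd positions below `t`. -/
def oddBelow (t i : ℕ) : Prop := Odd i ∧ i < t

/-- Serves the inclusion–exclusion both for permutations and for tableaux; `c m` will count objects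
whose descents are the odd positions below `2 * m + 1`. -/
theorem alternating_sum_telescope (c : ℕ → ℚ) (q : ℕ) :
    ∑ m ∈ Finset.range q, (-1) ^ m * (c (m + 1) + c m) + (-1) ^ q * c q = c 0 := by
  induction q with
  | zero => simp
  | succ q ih =>
    rw [Finset.sum_range_succ, pow_succ, ← ih]
    ring

section Entringer

open Classical in
/-- The number of permutations of `{0, …, n}` with descent pattern `d` and last value `r`,
defined by the recurrence of Entringer type. -/
noncomputable def entringer (d : ℕ → Prop) : ℕ → ℕ → ℚ
  | 0, r => if r = 0 then 1 else 0
  | n + 1, r => ∑ s ∈ Finset.range (n + 1), if (r ≤ s ↔ d (n + 1)) then entringer d n s else 0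

open Classical in
theorem entringer_congr {d d' : ℕ → Prop} {n : ℕ} (h : ∀ i, 1 ≤ i → i ≤ n → (d i ↔ d' i)) (r : ℕ) :
    entringer d n r = entringer d' n r := by
  induction n generalizing r with
  | zero => rfl
  | succ n ih =>
    refine Finset.sum_congr rfl fun s _ => ?_
    rw [ih fun i h1 h2 => h i h1 (h2.trans n.le_succ)]
    exact if_congr (by rw [h (n + 1) (by omega) le_rfl]) rfl rfl

theorem sum_range_choose_left (r k : ℕ) :
    ∑ s ∈ Finset.range r, (s.choose k : ℚ) = (r.choose (k + 1) : ℚ) := by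
  induction r with
  | zero => simp
  | succ r ih => rw [Finset.sum_range_succ, ih, Nat.choose_succ_succ]; push_cast; ring

/-- The permutations of `{0, …, n + k + 1}` whose last block of length `k + 1` is increasing,
split according to whether there is a descent in front of that block. -/
theorem entringer_add_entringer {d d' : ℕ → Prop} {n : ℕ}
    (h : ∀ i, 1 ≤ i → i ≤ n → (d i ↔ d' i)) (h₁ : d (n + 1)) (h₁' : ¬ d' (n + 1))
    (h₂ : ∀ i, n + 1 < i → ¬ d i) (h₂' : ∀ i, n + 1 < i → ¬ d' i) (k r : ℕ)
    (hr : r ≤ n + k + 1) :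
    entringer d (n + k + 1) r + entringer d' (n + k + 1) r =
      (r.choose k : ℚ) * ∑ s ∈ Finset.range (n + 1), entringer d n s := by
  induction k generalizing r with
  | zero =>
    simp only [entringer, h₁, h₁', Nat.choose_zero_right, Nat.cast_one, one_mul,
      ← Finset.sum_add_distrib, ← entringer_congr h]
    refine Finset.sum_congr rfl fun s _ => ?_
    by_cases hs : r ≤ s <;> simp [hs]
  | succ k ih =>
    rw [← sum_range_choose_left, Finset.sum_mul, ← add_assoc, entringer, entringer,
      ← Finset.sum_add_distrib]
    have hd := h₂ (n + k + 1 + 1) (by omega)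
    have hd' := h₂' (n + k + 1 + 1) (by omega)
    simp only [hd, hd', iff_false, not_le]
    -- No descent is allowed here, so only `s < r` contributes; the cut at `r` leaves the sum of
    -- binomial coefficients that raises `k` by one.
    rw [← Finset.sum_subset (Finset.range_mono (show r ≤ n + k + 1 + 1 by omega))]
    · refine Finset.sum_congr rfl fun s hs => ?_
      have hs := Finset.mem_range.1 hs
      rw [if_pos hs, if_pos hs, ih s (by omega)]
    · intro s _ hs
      have : ¬ s < r := fun h => hs (Finset.mem_range.2 h)
      simp [this]

theorem entringer_oddBelow_one (n r : ℕ) (hr : r ≤ n) :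
    entringer (oddBelow 1) n r = if r = n then 1 else 0 := by
  induction n generalizing r with
  | zero => simp [entringer]
  | succ n ih =>
    have : ¬ oddBelow 1 (n + 1) := fun h => by have := h.2; omega
    simp only [entringer, this, iff_false, not_le]
    rw [Finset.sum_range_succ, Finset.sum_eq_zero, zero_add, ih n le_rfl]
    · exact if_congr ⟨fun h => by omega, fun h => by omega⟩ (if_pos rfl) rfl
    · intro s hs
      have hs := Finset.mem_range.1 hs
      rw [ih s (by omega), if_neg (show s ≠ n by omega), ite_self]

/-- The number of permutations of `{0, …, n}` with descent pattern `d`. -/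
noncomputable def entringerSum (d : ℕ → Prop) (n : ℕ) : ℚ :=
  ∑ r ∈ Finset.range (n + 1), entringer d n r

theorem entringerSum_congr {d d' : ℕ → Prop} {n : ℕ}
    (h : ∀ i, 1 ≤ i → i ≤ n → (d i ↔ d' i)) : entringerSum d n = entringerSum d' n :=
  Finset.sum_congr rfl fun r _ => entringer_congr h r

/-- The two patterns differ only at position `2 * m + 1`. Ignoring that position, one chooses which
`k + 1` values form the final increasing block and arranges the rest alternatingly. -/
theorem entringerSum_add (m k : ℕ) :
    entringerSum (oddBelow (2 * (m + 1) + 1)) (2 * m + k + 1) +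
        entringerSum (oddBelow (2 * m + 1)) (2 * m + k + 1) =
      ((2 * m + k + 2).choose (k + 1) : ℚ) * entringerSum Odd (2 * m) := by
  rw [entringerSum, entringerSum, ← Finset.sum_add_distrib, ← sum_range_choose_left,
    Finset.sum_mul]
  refine Finset.sum_congr rfl fun r hr => ?_
  rw [entringer_add_entringer (n := 2 * m)]
  · congr 1
    exact entringerSum_congr fun i _ h => ⟨fun h => h.1, fun h' => ⟨h', by omega⟩⟩
  · intro i _ h
    exact ⟨fun h' => ⟨h'.1, by have := h'.1; grind⟩, fun h' => ⟨h'.1, by have := h'.2; omega⟩⟩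
  · exact ⟨⟨m, rfl⟩, by omega⟩
  · exact fun h => by have := h.2; omega
  · rintro i hi ⟨⟨j, rfl⟩, h⟩; omega
  · rintro i hi ⟨_, h⟩; omega
  · have := Finset.mem_range.1 hr; omega

/-- Telescoping from the pattern without descents, realised by the identity alone, to the full
alternating pattern. -/
theorem sum_choose_mul_entringerSum (q : ℕ) :
    ∑ m ∈ Finset.range (q + 1), (-1) ^ m *
      (((2 * q + 1).choose (2 * m + 1) : ℚ) * entringerSum Odd (2 * m)) = 1 := by
  have key := alternating_sum_telescope (fun m => entringerSum (oddBelow (2 * m + 1)) (2 * q)) q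
  have hzero : entringerSum (oddBelow (2 * 0 + 1)) (2 * q) = 1 := by
    rw [entringerSum, Finset.sum_congr rfl fun r hr =>
      entringer_oddBelow_one (2 * q) r (by have := Finset.mem_range.1 hr; omega)]
    simp
  rw [hzero] at key
  refine Eq.trans ?_ key
  rw [Finset.sum_range_succ]
  congr 1
  · refine Finset.sum_congr rfl fun m hm => ?_
    have hm := Finset.mem_range.1 hm
    obtain ⟨k, rfl⟩ : ∃ k, q = m + k + 1 := ⟨q - m - 1, by omega⟩
    have h := entringerSum_add m (2 * k + 1)
    rw [show 2 * m + (2 * k + 1) + 1 = 2 * (m + k + 1) by ring] at h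
    rw [h, ← Nat.choose_symm (show 2 * m + 1 ≤ 2 * (m + k + 1) + 1 by omega)]
    congr 4 <;> omega
  · rw [Nat.choose_self, Nat.cast_one, one_mul]
    congr 1
    exact entringerSum_congr fun i _ h => ⟨fun h' => ⟨h', by grind⟩, fun h' => h'.1⟩

end Entringer

/-! ### Euler numbers as Entringer sums -/

section Permutations

/-- `w` has a descent at the position `i` (counted from `1`) if and only if `d i` holds. -/
def HasDescentPattern (d : ℕ → Prop) {n : ℕ} (w : Equiv.Perm (Fin (n + 1))) : Prop :=
  ∀ i : Fin n, w i.succ < w i.castSucc ↔ d (i + 1)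

/-- Append the value `r` to a permutation, shifting the values at least `r` up. -/
def appendValue {n : ℕ} (r : Fin (n + 1)) (σ : Equiv.Perm (Fin n)) : Equiv.Perm (Fin (n + 1)) :=
  (finSuccEquivLast.trans (Equiv.optionCongr σ)).trans (finSuccEquiv' r).symm

@[simp]
theorem appendValue_last {n : ℕ} (r : Fin (n + 1)) (σ : Equiv.Perm (Fin n)) :
    appendValue r σ (Fin.last n) = r := by
  simp [appendValue]

@[simp]
theorem appendValue_castSucc {n : ℕ} (r : Fin (n + 1)) (σ : Equiv.Perm (Fin n)) (i : Fin n) :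
    appendValue r σ i.castSucc = r.succAbove (σ i) := by
  simp [appendValue]

theorem appendValue_bijective (n : ℕ) :
    Function.Bijective fun x : Fin (n + 1) × Equiv.Perm (Fin n) => appendValue x.1 x.2 := by
  rw [Fintype.bijective_iff_injective_and_card]
  constructor
  · rintro ⟨r, σ⟩ ⟨r', σ'⟩ h
    have hr : r = r' := by simpa using congrArg (fun w => w (Fin.last n)) h
    subst hr
    refine Prod.ext rfl (Equiv.ext fun i => ?_)
    simpa using congrArg (fun w => w i.castSucc) h
  · simp [Fintype.card_perm, Nat.factorial_succ]

theorem hasDescentPattern_appendValue {d : ℕ → Prop} {n : ℕ} (r : Fin (n + 2))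
    (σ : Equiv.Perm (Fin (n + 1))) :
    HasDescentPattern d (appendValue r σ) ↔
      HasDescentPattern d σ ∧ (r ≤ (σ (Fin.last n)).castSucc ↔ d (n + 1)) := by
  rw [HasDescentPattern, Fin.forall_fin_succ']
  refine and_congr (forall_congr' fun i => ?_) ?_
  · rw [Fin.succ_castSucc, appendValue_castSucc, appendValue_castSucc,
      Fin.succAbove_lt_succAbove_iff]
    rfl
  · rw [Fin.succ_last, appendValue_last, appendValue_castSucc, Fin.lt_succAbove_iff_le_castSucc]
    rfl

-- Deleting the last value and standardising inverts `appendValue`. A new last value `r` creates a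
-- descent exactly when the old last value is at least `r`, as it is then shifted up.
open Classical in
theorem card_hasDescentPattern_eq_entringer (d : ℕ → Prop) (n : ℕ) (r : Fin (n + 1)) :
    ((Finset.univ.filter fun w : Equiv.Perm (Fin (n + 1)) =>
      HasDescentPattern d w ∧ w (Fin.last n) = r).card : ℚ) = entringer d n r := by
  induction n with
  | zero =>
    have h : ∀ w : Equiv.Perm (Fin 1), HasDescentPattern d w ∧ w (Fin.last 0) = r :=
      fun w => ⟨fun i => i.elim0, Fin.ext (by omega)⟩
    have hr : (r : ℕ) = 0 := by omega
    simp only [h, entringer, hr]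
    simp
  | succ n ih =>
    have hcard : (Finset.univ.filter fun w : Equiv.Perm (Fin (n + 2)) =>
        HasDescentPattern d w ∧ w (Fin.last (n + 1)) = r).card =
        (Finset.univ.filter fun σ : Equiv.Perm (Fin (n + 1)) =>
          HasDescentPattern d σ ∧ (r ≤ (σ (Fin.last n)).castSucc ↔ d (n + 1))).card := by
      symm
      refine Finset.card_bij (fun σ _ => appendValue r σ) ?_ ?_ ?_
      · intro σ hσ
        rw [Finset.mem_filter] at hσ ⊢
        exact ⟨Finset.mem_univ _, (hasDescentPattern_appendValue r σ).2 hσ.2, appendValue_last r σ⟩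
      · intro σ _ σ' _ h
        exact (Prod.ext_iff.1 ((appendValue_bijective (n + 1)).1 (a₁ := (r, σ)) (a₂ := (r, σ')) h)).2
      · intro w hw
        obtain ⟨⟨r', σ⟩, rfl⟩ := (appendValue_bijective (n + 1)).2 w
        simp only [Finset.mem_filter, Finset.mem_univ, true_and, appendValue_last] at hw
        obtain ⟨hw, rfl⟩ := hw
        exact ⟨σ, by simpa using (hasDescentPattern_appendValue r' σ).1 hw, rfl⟩
    rw [hcard, Finset.card_eq_sum_card_fiberwise (f := fun σ => σ (Fin.last n))
      (t := Finset.univ) (fun _ _ => Finset.mem_coe.2 (Finset.mem_univ _)), Nat.cast_sum, entringer,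
      Finset.sum_range]
    refine Finset.sum_congr rfl fun s _ => ?_
    rw [Finset.filter_filter, ← ih s]
    split_ifs with h
    · congr 2
      ext σ
      simp only [Finset.mem_filter, Finset.mem_univ, true_and]
      refine ⟨fun h' => ⟨h'.1.1, h'.2⟩, fun h' => ⟨⟨h'.1, ?_⟩, h'.2⟩⟩
      rw [h'.2]
      exact h
    · rw [Nat.cast_eq_zero, Finset.card_eq_zero, Finset.filter_eq_empty_iff]
      rintro σ _ ⟨⟨_, h'⟩, rfl⟩
      exact h h'

theorem isAlternatingPerm_iff {n : ℕ} (w : Equiv.Perm (Fin (n + 1))) :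
    IsAlternatingPerm w ↔ HasDescentPattern Odd w := by
  have hmem : ∀ i : Fin n, ((i : ℕ) + 1 ∈ permDescentSet w ↔ w i.succ < w i.castSucc) := by
    intro i
    constructor
    · rintro ⟨a, b, ha, hb, h⟩
      have ha' : a = i.castSucc := Fin.ext (by simpa using ha)
      have hb' : b = i.succ := Fin.ext (by simpa using hb)
      rwa [ha', hb'] at h
    · exact fun h => ⟨i.castSucc, i.succ, rfl, rfl, h⟩
  constructor
  · intro h i
    rw [← hmem, h]
    exact ⟨fun h => h.1, fun h => ⟨h, by simp⟩⟩
  · intro h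
    ext i
    constructor
    · rintro ⟨a, b, rfl, hb, hab⟩
      have ha : (a : ℕ) < n := by omega
      exact ⟨(h ⟨a, ha⟩).1 ((hmem ⟨a, ha⟩).1 ⟨a, b, rfl, hb, hab⟩), by simp; omega⟩
    · rintro ⟨hodd, h1, h2⟩
      obtain ⟨j, rfl⟩ : ∃ j, i = j + 1 := ⟨i - 1, by omega⟩
      exact (hmem ⟨j, by omega⟩).2 ((h ⟨j, by omega⟩).2 hodd)

theorem eulerNumber_succ (n : ℕ) : (eulerNumber (n + 1) : ℚ) = entringerSum Odd n := by
  classical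
  rw [eulerNumber, Nat.card_congr (Equiv.subtypeEquivRight isAlternatingPerm_iff),
    Nat.card_eq_fintype_card, Fintype.card_subtype,
    Finset.card_eq_sum_card_fiberwise (f := fun w => w (Fin.last n))
      (t := Finset.univ) (fun _ _ => Finset.mem_coe.2 (Finset.mem_univ _)), Nat.cast_sum,
    entringerSum, Finset.sum_range]
  refine Finset.sum_congr rfl fun r _ => ?_
  rw [Finset.filter_filter, card_hasDescentPattern_eq_entringer]

/-- The recurrence of the odd Euler numbers that expresses `tan · cos = sin`. -/
theorem sum_choose_mul_eulerNumber (q : ℕ) :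
    ∑ m ∈ Finset.range (q + 1), (-1) ^ m *
      (((2 * q + 1).choose (2 * m + 1) : ℚ) * eulerNumber (2 * m + 1)) = 1 := by
  simpa only [eulerNumber_succ] using sum_choose_mul_entringerSum q

end Permutations

/-! ### The Euler functional -/

/-- The functional `X ^ k ↦ (-1) ^ ((k - 1) / 2) * E_k / 2 ^ k` for odd `k`, vanishing on even
polynomials; its exponential generating function is `tanh (y / 2)`. -/
noncomputable def eulerFunctional : ℚ[X] →ₗ[ℚ] ℚ :=
  momentFunctional fun k => if Odd k then (-1) ^ (k / 2) * (eulerNumber k : ℚ) / 2 ^ k else 0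

theorem sum_range_two_mul {M : Type*} [AddCommMonoid M] (f : ℕ → M) (n : ℕ) :
    ∑ k ∈ Finset.range (2 * n), f k = ∑ m ∈ Finset.range n, (f (2 * m) + f (2 * m + 1)) := by
  induction n with
  | zero => simp
  | succ n ih =>
    rw [Finset.sum_range_succ, ← ih, mul_add, mul_one, Finset.sum_range_succ,
      Finset.sum_range_succ, add_assoc]

theorem eulerFunctional_X_add_C_pow (h : ℚ) (n : ℕ) :
    eulerFunctional ((X + C h) ^ n) = ∑ k ∈ Finset.range (n + 1),
      ((n.choose k : ℚ) * h ^ (n - k)) *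
        if Odd k then (-1) ^ (k / 2) * (eulerNumber k : ℚ) / 2 ^ k else 0 := by
  rw [add_pow, map_sum]
  refine Finset.sum_congr rfl fun k _ => ?_
  have : X ^ k * C h ^ (n - k) * ((n.choose k : ℕ) : ℚ[X]) =
      C ((n.choose k : ℚ) * h ^ (n - k)) * X ^ k := by
    rw [C_mul, C_pow, ← C_eq_natCast]
    ring
  rw [this, eulerFunctional, momentFunctional_C_mul_X_pow, smul_eq_mul]

/-- Coefficientwise form of tanh(y/2) · (exp(y/2) + exp(-y/2)) = exp(y/2) - exp(-y/2). -/
theorem eulerFunctional_add_pow (n : ℕ) :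
    eulerFunctional ((X + C (1 / 2)) ^ n) + eulerFunctional ((X + C (-1 / 2)) ^ n) =
      (1 / 2) ^ n - (-1 / 2) ^ n := by
  have hneg : ∀ k : ℕ, (-1 / 2 : ℚ) ^ k = (-1) ^ k * (1 / 2) ^ k := fun k => by
    rw [← mul_pow]; norm_num
  rw [eulerFunctional_X_add_C_pow, eulerFunctional_X_add_C_pow, ← Finset.sum_add_distrib]
  simp only [hneg]
  rcases Nat.even_or_odd' n with ⟨q, rfl | rfl⟩
  -- For even `n` a term with `k` odd has `n - k` odd, so the two shifts cancel; terms with `k` even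
  -- vanish by definition of the functional.
  · rw [Finset.sum_eq_zero]
    · simp
    · intro k hk
      have hk := Finset.mem_range.1 hk
      split_ifs with hodd
      · have : Odd (2 * q - k) := by grind
        rw [this.neg_one_pow]
        ring
      · simp
  · rw [show 2 * q + 1 + 1 = 2 * (q + 1) by ring, sum_range_two_mul]
    have hterm : ∀ m ∈ Finset.range (q + 1), (((2 * q + 1).choose (2 * m) : ℚ) *
            (1 / 2) ^ (2 * q + 1 - 2 * m) *
            (if Odd (2 * m) then (-1) ^ (2 * m / 2) * (eulerNumber (2 * m) : ℚ) / 2 ^ (2 * m)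
              else 0) +
          ((2 * q + 1).choose (2 * m) : ℚ) *
            ((-1) ^ (2 * q + 1 - 2 * m) * (1 / 2) ^ (2 * q + 1 - 2 * m)) *
            (if Odd (2 * m) then (-1) ^ (2 * m / 2) * (eulerNumber (2 * m) : ℚ) / 2 ^ (2 * m)
              else 0) +
        (((2 * q + 1).choose (2 * m + 1) : ℚ) * (1 / 2) ^ (2 * q + 1 - (2 * m + 1)) *
            (if Odd (2 * m + 1) then (-1) ^ ((2 * m + 1) / 2) *
              (eulerNumber (2 * m + 1) : ℚ) / 2 ^ (2 * m + 1) else 0) +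
          ((2 * q + 1).choose (2 * m + 1) : ℚ) *
            ((-1) ^ (2 * q + 1 - (2 * m + 1)) * (1 / 2) ^ (2 * q + 1 - (2 * m + 1))) *
            (if Odd (2 * m + 1) then (-1) ^ ((2 * m + 1) / 2) *
              (eulerNumber (2 * m + 1) : ℚ) / 2 ^ (2 * m + 1) else 0))) =
        (1 / 2) ^ (2 * q) * ((-1) ^ m *
          (((2 * q + 1).choose (2 * m + 1) : ℚ) * eulerNumber (2 * m + 1))) := by
      intro m hm
      have hm := Finset.mem_range.1 hm
      obtain ⟨k, rfl⟩ : ∃ k, q = m + k := ⟨q - m, by omega⟩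
      rw [if_neg (by simp), if_pos ⟨m, rfl⟩, show (2 * m + 1) / 2 = m by omega,
        show 2 * (m + k) + 1 - (2 * m + 1) = 2 * k by omega, (even_two_mul k).neg_one_pow,
        mul_add 2 m k, pow_add _ (2 * m) (2 * k), pow_succ]
      simp only [one_div, inv_pow, mul_zero, zero_add, one_mul]
      field_simp
      ring
    rw [Finset.sum_congr rfl hterm, ← Finset.mul_sum, sum_choose_mul_eulerNumber]
    rw [(odd_two_mul_add_one q).neg_one_pow, pow_succ]
    ring

/-- The defining property `tanh (y / 2) * (1 + exp (-y)) = 1 - exp (-y)` of the functional. -/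
theorem eulerFunctional_add_comp (f : ℚ[X]) :
    eulerFunctional (f + f.comp (X - 1)) = f.eval 0 - f.eval (-1) := by
  have key : ∀ q : ℚ[X], eulerFunctional (q.comp (X + C (1 / 2)) + q.comp (X + C (-1 / 2))) =
      q.eval (1 / 2) - q.eval (-1 / 2) := by
    intro q
    induction q using Polynomial.induction_on' with
    | add p q hp hq =>
      rw [add_comp, add_comp, add_add_add_comm, map_add, hp, hq, eval_add, eval_add]
      ring
    | monomial n c =>
      rw [← smul_X_eq_monomial, smul_comp, smul_comp, X_pow_comp, X_pow_comp, ← smul_add, map_smul,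
        map_add, eulerFunctional_add_pow]
      simp [mul_sub]
  -- The half shift moves the symmetric pair of shifts ±1/2 to 0 and -1.
  have h := key (f.comp (X + C (-1 / 2)))
  rw [comp_assoc, comp_assoc] at h
  have h1 : (X + C (-1 / 2 : ℚ)).comp (X + C (1 / 2)) = X := by
    rw [add_comp, X_comp, C_comp, add_assoc, ← C_add]
    norm_num
  have h2 : (X + C (-1 / 2 : ℚ)).comp (X + C (-1 / 2)) = X - 1 := by
    rw [add_comp, X_comp, C_comp, add_assoc, ← C_add]
    norm_num
    rfl
  rw [h1, h2, comp_X] at h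
  rw [h, eval_comp, eval_comp]
  norm_num

/-! ### The difference equation for the coefficients of ((1+s)/(1-s))^X -/

/-- Multiplying the weight (u/(1-u))^X by u-1 gives -u times the weight for X-1; the normalisation
also changes sign, and the two signs cancel. -/
theorem betaMoment_succ_sub (k : ℕ) :
    betaMoment (k + 1) - betaMoment k = (betaMoment (k + 1)).comp (X - 1) := by
  have h1 : (ascPochhammer ℚ (k + 1 + 1)).comp (X - 1) = (X - 1) * ascPochhammer ℚ (k + 1) := by
    rw [ascPochhammer_succ_left, mul_comp, X_comp, comp_assoc]
    simp
  have h2 : C (2 / ((k + 1).factorial : ℚ)) =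
      C (2 / ((k + 1 + 1).factorial : ℚ)) * ((k : ℚ[X]) + 2) := by
    rw [← C_eq_natCast, show (2 : ℚ[X]) = C 2 from rfl, ← C_add, ← C_mul]
    congr 1
    rw [Nat.factorial_succ (k + 1)]
    have : ((k + 1).factorial : ℚ) ≠ 0 := by positivity
    push_cast
    field_simp
    ring
  rw [betaMoment, betaMoment, mul_comp, C_comp, h1, h2, ascPochhammer_succ_right ℚ (k + 1)]
  push_cast
  ring

/-- This is (1-s) F_X = (1+s) F_{X-1}, with F_X the generating function. For moments, y = 2X-1 has
y-1 = 2(X-1) and y+1 = 2X, which reduces it to `betaMoment_succ_sub`. -/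
theorem cayleyCoeff_succ_sub (n : ℕ) :
    cayleyCoeff (n + 1) - cayleyCoeff n = (cayleyCoeff (n + 1) + cayleyCoeff n).comp (X - 1) := by
  have key : ∀ q : ℚ[X], momentFunctional betaMoment (q * (X - 1)) =
      (momentFunctional betaMoment (q * X)).comp (X - 1) := by
    intro q
    induction q using Polynomial.induction_on' with
    | add p q hp hq => simp only [add_mul, map_add, hp, hq, add_comp]
    | monomial n c =>
      rw [mul_sub, mul_one, monomial_mul_X, map_sub, momentFunctional_monomial,
        momentFunctional_monomial, ← smul_sub, betaMoment_succ_sub, smul_comp]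
  rcases n with _ | n
  · simp only [cayleyCoeff, pow_zero]
    rw [← pow_zero X, momentFunctional_X_pow, betaMoment]
    simp only [zero_add, Nat.factorial_one, Nat.cast_one, div_one, ascPochhammer_one, add_comp,
      mul_comp, C_comp, X_comp, pow_zero, one_comp]
    rw [show (C 2 : ℚ[X]) = 2 from rfl]
    ring
  · have h1 : cayleyCoeff (n + 1 + 1) - cayleyCoeff (n + 1) =
        (2 : ℚ) • momentFunctional betaMoment ((C 2 * X - 1) ^ n * (X - 1)) := by
      rw [cayleyCoeff, cayleyCoeff, ← map_sub, ← map_smul, smul_eq_C_mul]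
      congr 1
      rw [show (C 2 : ℚ[X]) = 2 from rfl]
      ring
    have h2 : cayleyCoeff (n + 1 + 1) + cayleyCoeff (n + 1) =
        (2 : ℚ) • momentFunctional betaMoment ((C 2 * X - 1) ^ n * X) := by
      rw [cayleyCoeff, cayleyCoeff, ← map_add, ← map_smul, smul_eq_C_mul]
      congr 1
      rw [show (C 2 : ℚ[X]) = 2 from rfl]
      ring
    rw [h1, h2, key, smul_comp]

theorem eval_zero_cayleyCoeff (n : ℕ) : (cayleyCoeff n).eval 0 = if n = 0 then 1 else 0 := by
  rcases n with _ | n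
  · simp [cayleyCoeff]
  · rw [eval_cayleyCoeff_succ, momentFunctional_apply, if_neg n.succ_ne_zero]
    refine Finset.sum_eq_zero fun k _ => ?_
    simp [eval_betaMoment]

/-- The coefficients of `s ^ d * ((1 + s) / (1 - s)) ^ X`. -/
noncomputable def shiftedCoeff (d b : ℕ) : ℚ[X] := if d ≤ b then cayleyCoeff (b - d) else 0

theorem shiftedCoeff_succ_sub (d b : ℕ) : shiftedCoeff d (b + 1) - shiftedCoeff d b =
    (shiftedCoeff d (b + 1) + shiftedCoeff d b).comp (X - 1) := by
  unfold shiftedCoeff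
  rcases lt_trichotomy d (b + 1) with h | rfl | h
  · rw [if_pos h.le, if_pos (by omega), show b + 1 - d = b - d + 1 by omega, cayleyCoeff_succ_sub]
  · simp [cayleyCoeff]
  · simp [show ¬ d ≤ b + 1 by omega, show ¬ d ≤ b by omega]

theorem eval_zero_shiftedCoeff (d b : ℕ) :
    (shiftedCoeff d b).eval 0 = if b = d then 1 else 0 := by
  unfold shiftedCoeff
  split_ifs with h1 h2 h2
  · simp [eval_zero_cayleyCoeff, h2]
  · rw [eval_zero_cayleyCoeff, if_neg (by omega)]
  · omega
  · simp

/-- The substitution `X ↦ X - 1` turns partial sums into alternating partial sums. -/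
theorem sum_shiftedCoeff_comp (d b : ℕ) :
    (∑ c ∈ Finset.range (b + 1), shiftedCoeff d c).comp (X - 1) =
      ∑ c ∈ Finset.range (b + 1), (-1 : ℚ) ^ (b + c) • shiftedCoeff d c := by
  have hsucc : ∀ b, ∑ c ∈ Finset.range (b + 1 + 1), (-1 : ℚ) ^ (b + 1 + c) • shiftedCoeff d c =
      shiftedCoeff d (b + 1) -
        ∑ c ∈ Finset.range (b + 1), (-1 : ℚ) ^ (b + c) • shiftedCoeff d c := by
    intro b
    rw [Finset.sum_range_succ, (Even.add_self (b + 1)).neg_one_pow, one_smul, add_comm,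
      sub_eq_add_neg, ← Finset.sum_neg_distrib]
    congr 1
    refine Finset.sum_congr rfl fun c _ => ?_
    rw [add_right_comm, pow_succ, mul_neg_one, neg_smul]
  have hzero : (shiftedCoeff d 0).comp (X - 1) = shiftedCoeff d 0 := by
    unfold shiftedCoeff
    split_ifs <;> simp [cayleyCoeff]
  -- The second identity, the coefficient form of F_X - F_{X-1} = 2s/(1-s) · F_{X-1}, is carried
  -- along because the induction step for the first one uses it.
  have h : ∀ b, (∑ c ∈ Finset.range (b + 1), shiftedCoeff d c).comp (X - 1) =
        ∑ c ∈ Finset.range (b + 1), (-1 : ℚ) ^ (b + c) • shiftedCoeff d c ∧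
      2 * (∑ c ∈ Finset.range (b + 1), shiftedCoeff d c).comp (X - 1) =
        shiftedCoeff d (b + 1) - (shiftedCoeff d (b + 1)).comp (X - 1) := by
    intro b
    induction b with
    | zero =>
      have h := shiftedCoeff_succ_sub d 0
      rw [add_comp, hzero] at h
      simp only [zero_add, Finset.sum_range_one, hzero, pow_zero, one_smul, true_and] at h ⊢
      linear_combination -h
    | succ b ih =>
      obtain ⟨h1, h2⟩ := ih
      have h := shiftedCoeff_succ_sub d (b + 1)
      have h' := shiftedCoeff_succ_sub d b
      rw [add_comp] at h h'
      rw [hsucc, ← h1, Finset.sum_range_succ, add_comp]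
      constructor
      · linear_combination h2
      · linear_combination h2 - h
  exact (h b).1

/-! ### Jacobi–Trudi determinants and the shift X ↦ X - 1 -/

section Determinant

variable {p : ℕ}

/-- The determinant of Jacobi–Trudi type attached to `b = λ + δ`. -/
noncomputable def jacobiTrudi (b : Fin p → ℕ) : ℚ[X] :=
  (Matrix.of fun i j : Fin p => shiftedCoeff (Fin.rev j) (b i)).det

/-- The antisymmetric function supported on the permutations of `δ`, with value `1` at `δ`. -/
noncomputable def vacuum (b : Fin p → ℕ) : ℚ :=
  (Matrix.of fun i j : Fin p => if b i = (Fin.rev j : ℕ) then (1 : ℚ) else 0).det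

theorem eval_zero_jacobiTrudi (b : Fin p → ℕ) : (jacobiTrudi b).eval 0 = vacuum b := by
  rw [jacobiTrudi, ← coe_evalRingHom, RingHom.map_det, vacuum]
  congr 1
  ext i j
  simp [eval_zero_shiftedCoeff]

/-- The vectors of natural numbers that are at most `b` componentwise. -/
def box (b : Fin p → ℕ) : Finset (Fin p → ℕ) :=
  Fintype.piFinset fun i => Finset.range (b i + 1)

theorem mem_box {b c : Fin p → ℕ} : c ∈ box b ↔ ∀ i, c i ≤ b i := by
  simp [box, Fintype.mem_piFinset]

/-- Multilinearity of the determinant in its rows. -/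
theorem det_sum_smul_shiftedCoeff (b : Fin p → ℕ) (ε : ℕ → ℕ → ℚ) :
    (Matrix.of fun i j : Fin p =>
        ∑ c ∈ Finset.range (b i + 1), ε (b i) c • shiftedCoeff (Fin.rev j) c).det =
      ∑ c ∈ box b, (∏ i, ε (b i) (c i)) • jacobiTrudi c := by
  have h := (Matrix.detRowAlternating (R := ℚ[X]) (n := Fin p)).toMultilinearMap.map_sum_finset
    (fun i c => (fun j : Fin p => ε (b i) c • shiftedCoeff (Fin.rev j) c))
    (fun i => Finset.range (b i + 1))
  have h1 : (fun i : Fin p => ∑ c ∈ Finset.range (b i + 1),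
      (fun j : Fin p => ε (b i) c • shiftedCoeff (Fin.rev j) c)) =
      fun i j => ∑ c ∈ Finset.range (b i + 1), ε (b i) c • shiftedCoeff (Fin.rev j) c := by
    ext i j
    simp
  rw [h1] at h
  refine h.trans (Finset.sum_congr rfl fun c _ => ?_)
  have h2 := Matrix.det_mul_column (fun i => C (ε (b i) (c i)))
    (Matrix.of fun i j : Fin p => shiftedCoeff (Fin.rev j) (c i))
  rw [← map_prod, ← smul_eq_C_mul] at h2
  rw [jacobiTrudi, ← h2]
  simp only [smul_eq_C_mul]
  rfl

/-- Apply L(f + f(X-1)) = f(0) - f(-1) to f = the sum of all determinants below `b`; the shift acts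
row by row and inserts the sign of the size difference. -/
theorem sum_eulerFunctional_jacobiTrudi (b : Fin p → ℕ) :
    ∑ c ∈ box b, (1 + (-1) ^ (∑ i, b i + ∑ i, c i)) * eulerFunctional (jacobiTrudi c) =
      ∑ c ∈ box b, (1 - (-1) ^ (∑ i, b i + ∑ i, c i)) * vacuum c := by
  have hsign : ∀ c : Fin p → ℕ, ∏ i, (-1 : ℚ) ^ (b i + c i) = (-1) ^ (∑ i, b i + ∑ i, c i) := by
    intro c
    rw [Finset.prod_pow_eq_pow_sum, Finset.sum_add_distrib]
  have hS := det_sum_smul_shiftedCoeff b fun _ _ => 1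
  have hT := det_sum_smul_shiftedCoeff b fun b c => (-1) ^ (b + c)
  simp only [one_smul, Finset.prod_const_one] at hS
  simp only [hsign] at hT
  have hcomp : (∑ c ∈ box b, jacobiTrudi c).comp (X - 1) =
      ∑ c ∈ box b, ((-1 : ℚ) ^ (∑ i, b i + ∑ i, c i)) • jacobiTrudi c := by
    rw [← hS, ← hT, ← coe_compRingHom_apply, RingHom.map_det]
    congr 1
    ext1 i j
    simpa using sum_shiftedCoeff_comp (Fin.rev j) (b i)
  have h := eulerFunctional_add_comp (∑ c ∈ box b, jacobiTrudi c)
  have hev : (∑ c ∈ box b, jacobiTrudi c).eval (-1) =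
      ((∑ c ∈ box b, jacobiTrudi c).comp (X - 1)).eval 0 := by
    rw [eval_comp]
    simp
  rw [hev, hcomp, map_add, map_sum, map_sum, eval_finsetSum, eval_finsetSum,
    ← Finset.sum_add_distrib, ← Finset.sum_sub_distrib] at h
  simp only [map_smul, eval_smul, smul_eq_mul, eval_zero_jacobiTrudi] at h
  convert h using 2
  · ring
  · ring

end Determinant

/-! ### Pieri's rule and the recurrence for determinants -/

section Interlacing

variable {p : ℕ}

open Classical in
/-- The vectors `c ≤ b` that interlace with `b`: if `b = λ + δ` and `c = μ + δ`, this says that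
`λ / μ` is a horizontal strip. -/
noncomputable def interlaced (b : Fin p → ℕ) : Finset (Fin p → ℕ) :=
  (box b).filter fun c => ∀ i j, i < j → b j < c i

theorem mem_interlaced {b c : Fin p → ℕ} :
    c ∈ interlaced b ↔ (∀ i, c i ≤ b i) ∧ ∀ i j, i < j → b j < c i := by
  classical
  rw [interlaced, Finset.mem_filter, mem_box]

theorem self_mem_interlaced {b : Fin p → ℕ} (hb : StrictAnti b) : b ∈ interlaced b :=
  mem_interlaced.2 ⟨fun _ => le_rfl, fun _ _ h => hb h⟩

theorem strictAnti_of_mem_interlaced {b c : Fin p → ℕ} (h : c ∈ interlaced b) : StrictAnti c :=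
  fun i j hij => ((mem_interlaced.1 h).1 j).trans_lt ((mem_interlaced.1 h).2 i j hij)

/-- Pieri's rule for antisymmetric functions. -/
theorem sum_box_eq_sum_interlaced {b : Fin p → ℕ} (hb : StrictAnti b) {h : (Fin p → ℕ) → ℚ}
    (hanti : ∀ c i j, i ≠ j → h (c ∘ Equiv.swap i j) = -h c) (φ : ℕ → ℚ) :
    ∑ c ∈ box b, φ (∑ i, c i) * h c = ∑ c ∈ interlaced b, φ (∑ i, c i) * h c := by
  classical
  -- The interlacing conditions are imposed one row at a time: `m` counts the rows where they
  -- already hold.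
  have key : ∀ m : ℕ, ∑ c ∈ box b, φ (∑ i, c i) * h c =
      ∑ c ∈ (box b).filter fun c => ∀ i j : Fin p, i < j → (i : ℕ) < m → b j < c i,
        φ (∑ i, c i) * h c := by
    intro m
    induction m with
    | zero => simp
    | succ m ih =>
      rw [ih, ← Finset.sum_filter_add_sum_filter_not
        ((box b).filter fun c => ∀ i j : Fin p, i < j → (i : ℕ) < m → b j < c i)
        (fun c => ∀ i j : Fin p, i < j → (i : ℕ) = m → b j < c i), Finset.filter_filter,
        Finset.filter_filter]
      rw [add_eq_left.2]
      · refine Finset.sum_congr (Finset.filter_congr fun c _ => ?_) fun _ _ => rfl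
        constructor
        · rintro ⟨h1, h2⟩ i j hij hi
          rcases Nat.lt_succ_iff_lt_or_eq.1 hi with hi | hi
          exacts [h1 i j hij hi, h2 i j hij hi]
        · exact fun h => ⟨fun i j hij hi => h i j hij (by omega), fun i j hij hi => h i j hij (by omega)⟩
      · by_cases hm : m + 1 < p
        · set i₀ : Fin p := ⟨m, by omega⟩ with hi₀
          set i₁ : Fin p := ⟨m + 1, hm⟩ with hi₁
          have h01 : i₀ < i₁ := by simp [hi₀, hi₁]
          have hbad : ∀ c : Fin p → ℕ,
              (¬ ∀ i j : Fin p, i < j → (i : ℕ) = m → b j < c i) ↔ c i₀ ≤ b i₁ := by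
            intro c
            constructor
            · intro h
              push Not at h
              obtain ⟨i, j, hij, hi, hle⟩ := h
              have : i = i₀ := Fin.ext hi
              subst this
              refine hle.trans (hb.antitone ?_)
              rw [Fin.le_def]
              exact hij
            · exact fun h h' => absurd (h' i₀ i₁ h01 rfl) (not_lt.2 h)
          -- If row `i₀` violates interlacing, both of its coordinates and those of `i₁` are at most
          -- `b i₁`; swapping them stays in the box, keeps the total and negates `h`.
          refine Finset.sum_involution (fun c _ => c ∘ Equiv.swap i₀ i₁) ?_ ?_ ?_ ?_
          · intro c _
            rw [hanti c i₀ i₁ h01.ne]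
            simp only [Function.comp_apply]
            rw [Equiv.sum_comp (Equiv.swap i₀ i₁) c]
            ring
          · intro c _ hne heq
            apply hne
            have := hanti c i₀ i₁ h01.ne
            rw [heq] at this
            rw [show h c = 0 by linarith, mul_zero]
          · intro c hc
            rw [Finset.mem_filter, mem_box] at hc ⊢
            rw [hbad] at hc ⊢
            obtain ⟨hle, hlt, hc⟩ := hc
            refine ⟨fun i => ?_, fun i j hij hi => ?_, ?_⟩
            · rcases eq_or_ne i i₀ with rfl | h0
              · simpa using (hle i₁).trans (hb h01).le
              · rcases eq_or_ne i i₁ with rfl | h1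
                · simpa using hc
                · simpa [Equiv.swap_apply_of_ne_of_ne h0 h1] using hle i
            · have h0 : i ≠ i₀ := fun h => by simp [h, hi₀] at hi
              have h1 : i ≠ i₁ := fun h => by simp [h, hi₁] at hi
              simpa [Equiv.swap_apply_of_ne_of_ne h0 h1] using hlt i j hij hi
            · simpa using hle i₁
          · intro c _
            ext i
            simp
        · refine Finset.sum_eq_zero fun c hc => ?_
          exact absurd (fun i j hij hi => by have := j.2; have : (i : ℕ) < j := hij; omega)
            (Finset.mem_filter.1 hc).2.2
  rw [key p, interlaced]
  exact Finset.sum_congr (Finset.filter_congr fun c _ =>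
    ⟨fun h i j hij => h i j hij i.2, fun h i j hij _ => h i j hij⟩) fun _ _ => rfl

/-- The staircase `δ = (p - 1, …, 1, 0)`. -/
def stair (p : ℕ) (i : Fin p) : ℕ := (Fin.rev i : Fin p)

theorem strictAnti_stair (p : ℕ) : StrictAnti (stair p) := fun _ _ h => Fin.rev_lt_rev.2 h

theorem stair_le {c : Fin p → ℕ} (hc : StrictAnti c) (i : Fin p) : stair p i ≤ c i := by
  have h : ∀ k : ℕ, ∀ i : Fin p, (Fin.rev i : ℕ) = k → k ≤ c i := by
    intro k
    induction k with
    | zero => exact fun _ _ => Nat.zero_le _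
    | succ k ih =>
      intro i hi
      rw [Fin.val_rev] at hi
      have hlt : (i : ℕ) + 1 < p := by omega
      have h1 := ih ⟨i + 1, hlt⟩ (by rw [Fin.val_rev]; simp only; omega)
      have h2 : c ⟨i + 1, hlt⟩ < c i := hc (by rw [Fin.lt_def]; simp)
      omega
  exact h _ i rfl

/-- An excess over δ in any coordinate propagates to the first one, which is then at least `p`, and
its row in the determinant vanishes. -/
theorem vacuum_of_strictAnti {c : Fin p → ℕ} (hc : StrictAnti c) :
    vacuum c = if c = stair p then 1 else 0 := by
  split_ifs with h
  · subst h
    rw [vacuum, ← Matrix.det_one (n := Fin p)]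
    congr 1
    ext i j
    simp [Matrix.one_apply, stair, Fin.val_inj, Fin.rev_inj, -Fin.val_rev]
  · obtain ⟨i, hi⟩ : ∃ i, c i ≠ stair p i := by
      by_contra! h'
      exact h (funext h')
    have hlt : stair p i < c i := lt_of_le_of_ne (stair_le hc i) (Ne.symm hi)
    have hp : 0 < p := i.pos
    have h0 : p ≤ c ⟨0, hp⟩ := by
      have hmono : ∀ k : ℕ, ∀ j : Fin p, (j : ℕ) + k = i → stair p j < c j := by
        intro k
        induction k with
        | zero => intro j hj; rwa [show j = i from Fin.ext (by simpa using hj)]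
        | succ k ih =>
          intro j hj
          have hjp : (j : ℕ) + 1 < p := by have := i.2; omega
          have h1 := ih ⟨j + 1, hjp⟩ (by simp only; omega)
          have h2 : c ⟨j + 1, hjp⟩ < c j := hc (by rw [Fin.lt_def]; simp)
          simp only [stair, Fin.val_rev] at h1 ⊢
          omega
      have := hmono i ⟨0, hp⟩ (by simp)
      simp only [stair, Fin.val_rev] at this
      omega
    rw [vacuum]
    refine Matrix.det_eq_zero_of_row_eq_zero ⟨0, hp⟩ fun j => ?_
    rw [Matrix.of_apply, if_neg]
    have := (Fin.rev j).2
    omega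

theorem jacobiTrudi_comp_swap (c : Fin p → ℕ) {i j : Fin p} (hij : i ≠ j) :
    jacobiTrudi (c ∘ Equiv.swap i j) = -jacobiTrudi c := by
  have h := Matrix.det_permute (Equiv.swap i j)
    (Matrix.of fun i j : Fin p => shiftedCoeff (Fin.rev j) (c i))
  rw [Equiv.Perm.sign_swap hij] at h
  exact h.trans (by simp [jacobiTrudi])

theorem vacuum_comp_swap (c : Fin p → ℕ) {i j : Fin p} (hij : i ≠ j) :
    vacuum (c ∘ Equiv.swap i j) = -vacuum c := by
  rw [← eval_zero_jacobiTrudi, ← eval_zero_jacobiTrudi, jacobiTrudi_comp_swap c hij, eval_neg]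

open Classical in
/-- The recurrence that characterises the values of the determinants `jacobiTrudi`. -/
theorem sum_interlaced_eulerFunctional {b : Fin p → ℕ} (hb : StrictAnti b)
    (hodd : Odd (∑ i, b i + ∑ i, stair p i)) :
    ∑ c ∈ (interlaced b).filter fun c => Even (∑ i, b i + ∑ i, c i),
      eulerFunctional (jacobiTrudi c) = if stair p ∈ interlaced b then 1 else 0 := by
  have h := sum_eulerFunctional_jacobiTrudi b
  rw [sum_box_eq_sum_interlaced hb (h := fun c => eulerFunctional (jacobiTrudi c))
      (fun c i j hij => by rw [jacobiTrudi_comp_swap c hij, map_neg])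
      (fun s => 1 + (-1) ^ (∑ i, b i + s)),
    sum_box_eq_sum_interlaced hb (fun c i j hij => vacuum_comp_swap c hij)
      (fun s => 1 - (-1) ^ (∑ i, b i + s))] at h
  have hl : ∀ c ∈ interlaced b,
      (1 + (-1) ^ (∑ i, b i + ∑ i, c i)) * eulerFunctional (jacobiTrudi c) =
        2 * if Even (∑ i, b i + ∑ i, c i) then eulerFunctional (jacobiTrudi c) else 0 := by
    intro c _
    split_ifs with he
    · rw [he.neg_one_pow]; ring
    · rw [(Nat.not_even_iff_odd.1 he).neg_one_pow]; ring
  have hr : ∀ c ∈ interlaced b, (1 - (-1) ^ (∑ i, b i + ∑ i, c i)) * vacuum c =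
      2 * if c = stair p then 1 else 0 := by
    intro c hc
    rw [vacuum_of_strictAnti (strictAnti_of_mem_interlaced hc)]
    split_ifs with he
    · rw [he, hodd.neg_one_pow]; ring
    · simp
  rw [Finset.sum_congr rfl hl, Finset.sum_congr rfl hr, ← Finset.mul_sum, ← Finset.mul_sum,
    Finset.sum_ite_eq' (interlaced b), ← Finset.sum_filter] at h
  exact mul_left_cancel₀ two_ne_zero h

end Interlacing

/-! ### Tableaux as walks of shapes, and their recurrence -/

section Walks

variable {p : ℕ}

open Classical in
/-- The number of standard tableaux with shape given by `b = λ + δ`, with descent pattern `d`, and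
with the largest entry in the row `r`. The empty tableau is considered to end in the last row. -/
noncomputable def walkCount (d : ℕ → Prop) : ℕ → (Fin p → ℕ) → Fin p → ℚ
  | 0, b, s => if b = stair p ∧ (s : ℕ) + 1 = p then 1 else 0
  | n + 1, b, r => if StrictAnti b ∧ 0 < b r then
      ∑ s, if (s < r ↔ d n) then walkCount d n (Function.update b r (b r - 1)) s else 0 else 0

theorem walkCount_eq_zero {d : ℕ → Prop} {n : ℕ} {b : Fin p → ℕ} (hb : ¬ StrictAnti b) (r : Fin p) :
    walkCount d n b r = 0 := by
  cases n with
  | zero =>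
    exact if_neg fun h : b = stair p ∧ (r : ℕ) + 1 = p => hb (h.1 ▸ strictAnti_stair p)
  | succ n => exact if_neg fun h => hb h.1

open Classical in
theorem walkCount_congr {d d' : ℕ → Prop} {n : ℕ} (h : ∀ i < n, (d i ↔ d' i)) (b : Fin p → ℕ)
    (r : Fin p) : walkCount d n b r = walkCount d' n b r := by
  induction n generalizing b r with
  | zero => rfl
  | succ n ih =>
    refine if_congr Iff.rfl (Finset.sum_congr rfl fun s _ => ?_) rfl
    rw [ih fun i hi => h i (by omega)]
    exact if_congr (by rw [h n (by omega)]) rfl rfl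

/-- The number of standard tableaux with shape given by `b = λ + δ` and descent pattern `d`. -/
noncomputable def walkTotal (d : ℕ → Prop) (n : ℕ) (b : Fin p → ℕ) : ℚ := ∑ r, walkCount d n b r

theorem walkTotal_congr {d d' : ℕ → Prop} {n : ℕ} (h : ∀ i < n, (d i ↔ d' i)) (b : Fin p → ℕ) :
    walkTotal d n b = walkTotal d' n b :=
  Finset.sum_congr rfl fun r _ => walkCount_congr h b r

theorem sum_sum_filter_of_existsUnique {α β : Type*} (S : Finset β) (T : Finset α)
    (R : β → α → Prop) [∀ s, DecidablePred (R s)] (h : ∀ c ∈ T, ∃! s, s ∈ S ∧ R s c) (f : α → ℚ) :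
    ∑ s ∈ S, ∑ c ∈ T.filter (R s), f c = ∑ c ∈ T, f c := by
  simp only [Finset.sum_filter]
  rw [Finset.sum_comm]
  refine Finset.sum_congr rfl fun c hc => ?_
  obtain ⟨s, ⟨hs, hR⟩, huniq⟩ := h c hc
  rw [Finset.sum_eq_single_of_mem s hs fun s' hs' hne =>
    if_neg fun hR' => hne (huniq s' ⟨hs', hR'⟩), if_pos hR]

/-- `r` is the first coordinate where `c` is smaller than `b`. -/
def FirstDrop (b c : Fin p → ℕ) (r : Fin p) : Prop := (∀ i < r, c i = b i) ∧ c r < b r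

theorem existsUnique_firstDrop {b c : Fin p → ℕ} (hle : ∀ i, c i ≤ b i)
    (hlt : ∑ i, c i < ∑ i, b i) : ∃! r, FirstDrop b c r := by
  obtain ⟨r, hr, hmin⟩ : ∃ r, c r < b r ∧ ∀ i, c i < b i → r ≤ i := by
    obtain ⟨i, -, hi⟩ := Finset.exists_lt_of_sum_lt hlt
    have hne : (Finset.univ.filter fun i => c i < b i).Nonempty :=
      ⟨i, Finset.mem_filter.2 ⟨Finset.mem_univ i, hi⟩⟩
    exact ⟨_, (Finset.mem_filter.1 (Finset.min'_mem _ hne)).2, fun i hi =>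
      Finset.min'_le _ i (Finset.mem_filter.2 ⟨Finset.mem_univ i, hi⟩)⟩
  refine ⟨r, ⟨fun i hi => ?_, hr⟩, fun s hs => ?_⟩
  · by_contra h
    exact absurd (hmin i (lt_of_le_of_ne (hle i) h)) (not_le.2 hi)
  · refine le_antisymm ?_ (hmin s hs.2)
    by_contra h
    exact hr.ne (hs.1 r (not_le.1 h))

open Classical in
/-- The shapes obtained by removing a horizontal strip of size `k` with topmost row `r`. -/
noncomputable def stripFrom (b : Fin p → ℕ) (k : ℕ) (r : Fin p) : Finset (Fin p → ℕ) :=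
  ((interlaced b).filter fun c => ∑ i, c i + k = ∑ i, b i).filter fun c => FirstDrop b c r

theorem sum_update_sub_one {b : Fin p → ℕ} {r : Fin p} (hr : 0 < b r) :
    ∑ i, Function.update b r (b r - 1) i + 1 = ∑ i, b i := by
  rw [Finset.sum_update_of_mem (Finset.mem_univ r), ← Finset.add_sum_erase _ b (Finset.mem_univ r),
    Finset.sdiff_singleton_eq_erase]
  omega

/-- Removing a strip with topmost row `r` amounts to removing one cell from the row `r`, and then a
strip that leaves the rows above `r` unchanged. -/
theorem mem_stripFrom_succ {b c : Fin p → ℕ} (hb : StrictAnti b) {r : Fin p} (hr : 0 < b r)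
    (k : ℕ) : c ∈ stripFrom b (k + 1) r ↔ c ∈ interlaced (Function.update b r (b r - 1)) ∧
      ∑ i, c i + k = ∑ i, Function.update b r (b r - 1) i ∧
      ∀ i < r, c i = Function.update b r (b r - 1) i := by
  classical
  have hsum := sum_update_sub_one hr
  rw [stripFrom, Finset.mem_filter, Finset.mem_filter, mem_interlaced, mem_interlaced]
  constructor
  · rintro ⟨⟨⟨h1, h2⟩, h3⟩, h4, h5⟩
    refine ⟨⟨fun i => ?_, fun i j hij => ?_⟩, by omega, fun i hi => ?_⟩
    · rcases eq_or_ne i r with rfl | h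
      · rw [Function.update_self]; omega
      · rw [Function.update_of_ne h]; exact h1 i
    · have := h2 i j hij
      rcases eq_or_ne j r with rfl | h
      · rw [Function.update_self]; omega
      · rw [Function.update_of_ne h]; exact this
    · rw [Function.update_of_ne hi.ne]; exact h4 i hi
  · rintro ⟨⟨h1, h2⟩, h3, h4⟩
    have h4' : ∀ i < r, c i = b i := fun i hi => by
      rw [h4 i hi, Function.update_of_ne hi.ne]
    have hr' : c r < b r := by
      have := h1 r
      rw [Function.update_self] at this
      omega
    refine ⟨⟨⟨fun i => ?_, fun i j hij => ?_⟩, by omega⟩, h4', hr'⟩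
    · rcases eq_or_ne i r with rfl | h
      · exact hr'.le
      · have := h1 i
        rwa [Function.update_of_ne h] at this
    · rcases eq_or_ne j r with rfl | h
      · rw [h4' i hij]; exact hb hij
      · have := h2 i j hij
        rwa [Function.update_of_ne h] at this

theorem stripFrom_succ_eq_empty {b : Fin p → ℕ} (hb : StrictAnti b) {r : Fin p} (k : ℕ)
    (h : ¬ (0 < b r ∧ StrictAnti (Function.update b r (b r - 1)))) :
    stripFrom b (k + 1) r = ∅ := by
  classical
  refine Finset.eq_empty_of_forall_notMem fun c hc => h ?_
  have hr : 0 < b r := (Nat.zero_le _).trans_lt (Finset.mem_filter.1 hc).2.2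
  have := ((mem_stripFrom_succ hb hr k).1 hc).1
  rw [mem_interlaced] at this
  exact ⟨hr, fun i j hij => (this.2 i j hij).trans_le (this.1 i)⟩

/-- The tableaux whose last block of length `k + 1` has no descents, split according to whether
there is a descent in front of that block. -/
theorem walkCount_add_walkCount {d d' : ℕ → Prop} {n : ℕ}
    (h : ∀ i < n, (d i ↔ d' i)) (h₁ : d n) (h₁' : ¬ d' n)
    (h₂ : ∀ i, n < i → ¬ d i) (h₂' : ∀ i, n < i → ¬ d' i) (k : ℕ) {b : Fin p → ℕ}
    (hb : StrictAnti b) (r : Fin p) :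
    walkCount d (n + k + 1) b r + walkCount d' (n + k + 1) b r =
      ∑ c ∈ stripFrom b (k + 1) r, walkTotal d n c := by
  classical
  by_cases hr : 0 < b r ∧ StrictAnti (Function.update b r (b r - 1))
  swap
  · rw [stripFrom_succ_eq_empty hb k hr, Finset.sum_empty, walkCount, walkCount]
    by_cases hr0 : 0 < b r
    · have hn : ¬ StrictAnti (Function.update b r (b r - 1)) := fun h => hr ⟨hr0, h⟩
      simp [walkCount_eq_zero hn]
    · simp [hr0]
  obtain ⟨hr, hb'⟩ := hr
  induction k generalizing b r with
  | zero =>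
    rw [walkCount, walkCount, if_pos ⟨hb, hr⟩, if_pos ⟨hb, hr⟩, ← Finset.sum_add_distrib]
    have hstrip : stripFrom b (0 + 1) r = {Function.update b r (b r - 1)} := by
      ext c
      rw [mem_stripFrom_succ hb hr, Finset.mem_singleton]
      constructor
      · rintro ⟨hc, hsum, -⟩
        have := (mem_interlaced.1 hc).1
        funext i
        exact (Finset.sum_eq_sum_iff_of_le fun i _ => this i).1 (by simpa using hsum) i
          (Finset.mem_univ i)
      · rintro rfl
        exact ⟨self_mem_interlaced hb', by simp, fun _ _ => rfl⟩
    rw [hstrip, Finset.sum_singleton, walkTotal]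
    refine Finset.sum_congr rfl fun s _ => ?_
    simp only [h₁, h₁', ← walkCount_congr h]
    by_cases hs : s < r <;> simp [hs]
  | succ k ih =>
    rw [← add_assoc, walkCount, walkCount, if_pos ⟨hb, hr⟩, if_pos ⟨hb, hr⟩,
      ← Finset.sum_add_distrib]
    have hd := h₂ (n + k + 1) (by omega)
    have hd' := h₂' (n + k + 1) (by omega)
    simp only [hd, hd', iff_false]
    set b' := Function.update b r (b r - 1) with hb'def
    have hstep : ∀ s, walkCount d (n + k + 1) b' s + walkCount d' (n + k + 1) b' s =
        ∑ c ∈ stripFrom b' (k + 1) s, walkTotal d n c := by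
      intro s
      by_cases hs : 0 < b' s ∧ StrictAnti (Function.update b' s (b' s - 1))
      · exact ih hb' s hs.1 hs.2
      · rw [stripFrom_succ_eq_empty hb' k hs, Finset.sum_empty, walkCount, walkCount]
        by_cases hs0 : 0 < b' s
        · have hn : ¬ StrictAnti (Function.update b' s (b' s - 1)) := fun h => hs ⟨hs0, h⟩
          simp [walkCount_eq_zero hn]
        · simp [hs0]
    rw [← sum_sum_filter_of_existsUnique Finset.univ (stripFrom b (k + 1 + 1) r)
      (fun s c => FirstDrop b' c s)]
    · refine Finset.sum_congr rfl fun s _ => ?_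
      by_cases hs : s < r
      -- The strip leaves the rows above `r` unchanged, so its next topmost row cannot lie above
      -- `r`: within a descent-free block the entries move weakly upwards.
      · rw [if_neg (not_not.2 hs), if_neg (not_not.2 hs), Finset.filter_eq_empty_iff.2]
        · simp
        · intro c hc hdrop
          have := ((mem_stripFrom_succ hb hr _).1 hc).2.2 s hs
          exact hdrop.2.ne this
      · rw [if_pos hs, if_pos hs, hstep]
        refine Finset.sum_congr (Finset.ext fun c => ?_) fun _ _ => rfl
        rw [Finset.mem_filter, mem_stripFrom_succ hb hr, stripFrom, Finset.mem_filter,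
          Finset.mem_filter]
        constructor
        · rintro ⟨⟨h1, h2⟩, h3⟩
          exact ⟨⟨h1, h2, fun i hi => h3.1 i (hi.trans_le (not_lt.1 hs))⟩, h3⟩
        · rintro ⟨⟨h1, h2, -⟩, h3⟩
          exact ⟨⟨h1, h2⟩, h3⟩
    · intro c hc
      obtain ⟨h1, h2, -⟩ := (mem_stripFrom_succ hb hr _).1 hc
      simpa using existsUnique_firstDrop (mem_interlaced.1 h1).1
        (show ∑ i, c i < ∑ i, b' i by rw [← h2]; omega)

open Classical in
theorem walkTotal_add_walkTotal {d d' : ℕ → Prop} {n : ℕ}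
    (h : ∀ i < n, (d i ↔ d' i)) (h₁ : d n) (h₁' : ¬ d' n)
    (h₂ : ∀ i, n < i → ¬ d i) (h₂' : ∀ i, n < i → ¬ d' i) (k : ℕ) {b : Fin p → ℕ}
    (hb : StrictAnti b) :
    walkTotal d (n + k + 1) b + walkTotal d' (n + k + 1) b =
      ∑ c ∈ (interlaced b).filter fun c => ∑ i, c i + (k + 1) = ∑ i, b i, walkTotal d n c := by
  rw [walkTotal, walkTotal, ← Finset.sum_add_distrib,
    ← sum_sum_filter_of_existsUnique Finset.univ _ (fun s c => FirstDrop b c s)]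
  · exact Finset.sum_congr rfl fun r _ => walkCount_add_walkCount h h₁ h₁' h₂ h₂' k hb r
  · intro c hc
    rw [Finset.mem_filter] at hc
    simpa using existsUnique_firstDrop (mem_interlaced.1 hc.1).1
      (show ∑ i, c i < ∑ i, b i by rw [← hc.2]; omega)

end Walks

section Walks

variable {p : ℕ}

/-- The empty tableau ends in the last row by convention, and no row lies below it, so a descent at
0 is impossible. -/
theorem walkTotal_eq_zero_of_descent_zero {d : ℕ → Prop} (h : d 0) (n : ℕ)
    {b : Fin p → ℕ} : walkTotal d (n + 1) b = 0 := by
  classical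
  refine Finset.sum_eq_zero fun r _ => ?_
  induction n generalizing b r with
  | zero =>
    rw [walkCount]
    split_ifs
    · refine Finset.sum_eq_zero fun s _ => ?_
      split_ifs with hs
      · refine if_neg fun hlast : _ ∧ (s : ℕ) + 1 = p => ?_
        have h1 : (s : ℕ) < r := hs.2 h
        have h2 := r.2
        omega
      · rfl
    · rfl
  | succ n ih =>
    rw [walkCount]
    split_ifs
    · exact Finset.sum_eq_zero fun s _ => by rw [ih s (Finset.mem_univ s), ite_self]
    · rfl

theorem sum_stair_le {c : Fin p → ℕ} (hc : StrictAnti c) : ∑ i, stair p i ≤ ∑ i, c i :=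
  Finset.sum_le_sum fun i _ => stair_le hc i

open Classical in
theorem walkTotal_oddBelow_one (hp : 0 < p) {b : Fin p → ℕ} (hb : StrictAnti b) (n : ℕ)
    (hsum : ∑ i, b i = ∑ i, stair p i + (n + 1)) :
    walkTotal (oddBelow 1) (n + 1) b = if stair p ∈ interlaced b then 1 else 0 := by
  -- The impossible descent at 0 supplies a vanishing partner, so the splitting at `n = 0` counts
  -- descent-free tableaux as strips down to δ.
  have h := walkTotal_add_walkTotal (d := fun i => i = 0) (d' := oddBelow 1) (n := 0) (by simp) rfl
    (fun h => by have := h.1; simp at this) (fun i hi h => hi.ne h.symm)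
    (fun i hi h => by have := h.2; omega) n hb
  rw [zero_add, walkTotal_eq_zero_of_descent_zero (d := fun i => i = 0) rfl n, zero_add] at h
  have hzero : ∀ c : Fin p → ℕ, walkTotal (fun i => i = 0) 0 c = if c = stair p then 1 else 0 := by
    intro c
    rw [walkTotal, Finset.sum_eq_single (⟨p - 1, by omega⟩ : Fin p)]
    · refine if_congr (and_iff_left ?_) rfl rfl
      simp only
      omega
    · intro s _ hs
      refine if_neg fun h : _ ∧ (s : ℕ) + 1 = p => hs (Fin.ext ?_)
      simp only
      omega
    · simp
  rw [h, Finset.sum_congr rfl fun c _ => hzero c, Finset.sum_ite_eq']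
  refine if_congr ?_ rfl rfl
  rw [Finset.mem_filter, and_iff_left]
  omega

-- The tableau analogue of `sum_choose_mul_entringerSum`: strips replace binomial coefficients, and
-- the starting pattern forces a single row.
open Classical in
theorem sum_walkTotal (hp : 0 < p) {b : Fin p → ℕ} (hb : StrictAnti b) (q : ℕ)
    (hsum : ∑ i, b i = ∑ i, stair p i + (2 * q + 1)) :
    ∑ m ∈ Finset.range (q + 1), (-1) ^ m *
      ∑ c ∈ (interlaced b).filter fun c => ∑ i, c i = ∑ i, stair p i + (2 * m + 1),
        walkTotal Odd (2 * m + 1) c = if stair p ∈ interlaced b then 1 else 0 := by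
  rw [← walkTotal_oddBelow_one hp hb (2 * q) hsum,
    ← alternating_sum_telescope (fun m => walkTotal (oddBelow (2 * m + 1)) (2 * q + 1) b) q,
    Finset.sum_range_succ]
  congr 1
  · refine Finset.sum_congr rfl fun m hm => ?_
    have hm := Finset.mem_range.1 hm
    obtain ⟨k, rfl⟩ : ∃ k, q = m + k + 1 := ⟨q - m - 1, by omega⟩
    have h := walkTotal_add_walkTotal (d := oddBelow (2 * (m + 1) + 1))
      (d' := oddBelow (2 * m + 1)) (n := 2 * m + 1)
      (fun i hi => ⟨fun h => ⟨h.1, hi⟩, fun h => ⟨h.1, by omega⟩⟩) ⟨⟨m, rfl⟩, by omega⟩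
      (fun h => by have := h.2; omega)
      (by rintro i hi ⟨⟨j, rfl⟩, h⟩; omega) (by rintro i hi ⟨-, h⟩; omega) (2 * k + 1) hb
    rw [show 2 * m + 1 + (2 * k + 1) + 1 = 2 * (m + k + 1) + 1 by ring] at h
    rw [h]
    congr 1
    refine Finset.sum_congr (Finset.filter_congr fun c _ => by omega) fun c _ => ?_
    exact walkTotal_congr (fun i hi => ⟨fun h => ⟨h, by omega⟩, fun h => h.1⟩) c
  · congr 1
    have hfilter : ((interlaced b).filter fun c => ∑ i, c i = ∑ i, stair p i + (2 * q + 1)) =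
        {b} := by
      ext c
      rw [Finset.mem_filter, Finset.mem_singleton, ← hsum]
      constructor
      · rintro ⟨hc, h⟩
        funext i
        exact (Finset.sum_eq_sum_iff_of_le fun i _ => (mem_interlaced.1 hc).1 i).1 h i
          (Finset.mem_univ i)
      · rintro rfl
        exact ⟨self_mem_interlaced hb, rfl⟩
    rw [hfilter, Finset.sum_singleton]
    exact walkTotal_congr (fun i hi => ⟨fun h => ⟨h, by omega⟩, fun h => h.1⟩) b

/-- Up to a sign, the number of alternating tableaux with an odd number of cells is the value of
the Euler functional at the determinant of Jacobi–Trudi type. -/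
theorem walkTotal_eq_eulerFunctional (hp : 0 < p) (q : ℕ) {b : Fin p → ℕ} (hb : StrictAnti b)
    (hsum : ∑ i, b i = ∑ i, stair p i + (2 * q + 1)) :
    (-1) ^ q * walkTotal Odd (2 * q + 1) b = eulerFunctional (jacobiTrudi b) := by
  classical
  induction q using Nat.strong_induction_on generalizing b with
  | _ q ih =>
    -- The signed count for all shapes at once, with the number of cells read off from `c`.
    -- Comparing the two recurrences, every term with fewer cells agrees by induction, so the
    -- remaining term `c = b` agrees as well.
    set X : (Fin p → ℕ) → ℚ := fun c => (-1) ^ ((∑ i, c i - ∑ i, stair p i) / 2) *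
      walkTotal Odd (∑ i, c i - ∑ i, stair p i) c with hX
    have hXval : ∀ (m : ℕ) (c : Fin p → ℕ), ∑ i, c i = ∑ i, stair p i + (2 * m + 1) →
        X c = (-1) ^ m * walkTotal Odd (2 * m + 1) c := by
      intro m c hc
      simp only [hX, hc, Nat.add_sub_cancel_left]
      rw [show (2 * m + 1) / 2 = m by omega]
    have hsize : ∀ c ∈ (interlaced b).filter fun c => Even (∑ i, b i + ∑ i, c i),
        ∃ m ≤ q, ∑ i, c i = ∑ i, stair p i + (2 * m + 1) := by
      intro c hc
      rw [Finset.mem_filter] at hc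
      have h1 := sum_stair_le (strictAnti_of_mem_interlaced hc.1)
      have h2 : ∑ i, c i ≤ ∑ i, b i := Finset.sum_le_sum fun i _ => (mem_interlaced.1 hc.1).1 i
      obtain ⟨t, ht⟩ := hc.2
      exact ⟨(∑ i, c i - ∑ i, stair p i) / 2, by omega, by omega⟩
    have hsumX : ∑ c ∈ (interlaced b).filter fun c => Even (∑ i, b i + ∑ i, c i), X c =
        if stair p ∈ interlaced b then 1 else 0 := by
      rw [← sum_walkTotal hp hb q hsum, ← sum_sum_filter_of_existsUnique (Finset.range (q + 1)) _
        (fun m c => ∑ i, c i = ∑ i, stair p i + (2 * m + 1))]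
      · refine Finset.sum_congr rfl fun m _ => ?_
        rw [Finset.mul_sum]
        refine Finset.sum_congr (Finset.ext fun c => ?_) fun c hc =>
          hXval m c (Finset.mem_filter.1 hc).2
        rw [Finset.mem_filter, Finset.mem_filter, Finset.mem_filter, and_assoc]
        refine and_congr_right fun _ => and_iff_right_of_imp fun h => ?_
        rw [hsum, h]
        exact ⟨∑ i, stair p i + q + m + 1, by ring⟩
      · intro c hc
        obtain ⟨m, hm, h⟩ := hsize c hc
        refine ⟨m, ⟨Finset.mem_range.2 (by omega), h⟩, fun m' hm' => ?_⟩
        have := hm'.2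
        omega
    have hbmem : b ∈ (interlaced b).filter fun c => Even (∑ i, b i + ∑ i, c i) :=
      Finset.mem_filter.2 ⟨self_mem_interlaced hb, Even.add_self _⟩
    have hodd : Odd (∑ i, b i + ∑ i, stair p i) := by
      rw [hsum]
      exact ⟨∑ i, stair p i + q, by ring⟩
    have heq := hsumX.trans (sum_interlaced_eulerFunctional hb hodd).symm
    rw [← Finset.add_sum_erase _ _ hbmem, ← Finset.add_sum_erase _ _ hbmem,
      Finset.sum_congr rfl (g := fun c => eulerFunctional (jacobiTrudi c)) ?_] at heq
    · rw [← hXval q b hsum]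
      exact add_right_cancel heq
    · intro c hc
      rw [Finset.mem_erase] at hc
      obtain ⟨m, hm, h⟩ := hsize c hc.2
      have hcb := (Finset.mem_filter.1 hc.2).1
      rcases hm.lt_or_eq with hm | rfl
      · rw [hXval m c h, ih m hm (strictAnti_of_mem_interlaced hcb) h]
      · refine absurd (_root_.funext fun i => ?_) hc.1
        exact (Finset.sum_eq_sum_iff_of_le fun i _ => (mem_interlaced.1 hcb).1 i).1
          (h.trans hsum.symm) i (Finset.mem_univ i)

end Walks

/-! ### Evaluation at the square shape -/

section Square

theorem sign_revPerm (p : ℕ) :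
    ((Equiv.Perm.sign (Fin.revPerm : Equiv.Perm (Fin p)) : ℤ) : ℚ) =
      (-1) ^ (∑ i ∈ Finset.range p, i) := by
  rw [Equiv.Perm.sign_eq_prod_prod_Iio]
  have h : ∀ j : Fin p, ∏ i ∈ Finset.Iio j,
      (if Fin.revPerm i < Fin.revPerm j then (1 : ℤˣ) else -1) = (-1) ^ (j : ℕ) := by
    intro j
    rw [Finset.prod_congr rfl (g := fun _ => (-1 : ℤˣ)), Finset.prod_const, Fin.card_Iio]
    intro i hi
    exact if_neg (not_lt.2 (Fin.rev_lt_rev.2 (Finset.mem_Iio.1 hi)).le)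
  rw [Finset.prod_congr rfl fun j _ => h j, Finset.prod_pow_eq_pow_sum, Finset.sum_range]
  simp

/-- The vector `λ + δ` for the square shape. -/
def squareVector (p : ℕ) (i : Fin p) : ℕ := p + stair p i

theorem strictAnti_squareVector (p : ℕ) : StrictAnti (squareVector p) :=
  fun _ _ h => Nat.add_lt_add_left (strictAnti_stair p h) p

theorem sum_squareVector (p : ℕ) : ∑ i, squareVector p i = ∑ i, stair p i + p ^ 2 := by
  simp [squareVector, Finset.sum_add_distrib, sq, add_comm]

/-- The index in row `i`, column `j` is `p - i + j`; reversing the rows makes it `i + j + 1`. -/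
theorem jacobiTrudi_squareVector (p : ℕ) : jacobiTrudi (squareVector p) =
    C ((-1) ^ (∑ i ∈ Finset.range p, i)) *
      (Matrix.of fun i j : Fin p => cayleyCoeff (i + j + 1)).det := by
  have h := Matrix.det_permute (Fin.revPerm : Equiv.Perm (Fin p))
    (Matrix.of fun i j : Fin p => cayleyCoeff (i + j + 1))
  have hmat : (Matrix.of fun i j : Fin p => shiftedCoeff (Fin.rev j) (squareVector p i)) =
      (Matrix.of fun i j : Fin p => cayleyCoeff (i + j + 1)).submatrix Fin.revPerm id := by
    ext1 i j
    have hj := j.2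
    have hi := i.2
    rw [Matrix.of_apply, Matrix.submatrix_apply, Matrix.of_apply, shiftedCoeff, if_pos]
    · congr 1
      simp only [squareVector, stair, Fin.revPerm_apply, Fin.val_rev, id]
      omega
    · simp only [squareVector, stair, Fin.val_rev]
      omega
  rw [jacobiTrudi, hmat, h, ← sign_revPerm, C_eq_intCast]

theorem umbralEval_eq (P : ℚ[X]) :
    umbralEval P = momentFunctional (fun k => (eulerNumber k : ℚ)) P := rfl

/-- Since `p` is odd only odd powers occur. Each additional factor (2X)^2 contributes the sign -1,
which the argument of `Q` compensates, leaving a sign that depends only on `p`. -/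
theorem eulerFunctional_mul_comp (p : ℕ) (hp : Odd p) (Q : ℚ[X]) :
    eulerFunctional ((C 2 * X) ^ p * Q.comp (-(C 2 * X) ^ 2)) =
      (-1) ^ (p / 2) * umbralEval (X ^ p * Q.comp (X ^ 2)) := by
  rw [umbralEval_eq]
  induction Q using Polynomial.induction_on' with
  | add P Q hP hQ => simp only [add_comp, mul_add, map_add, hP, hQ]
  | monomial n c =>
    have h1 : (C 2 * X : ℚ[X]) ^ p * (monomial n c).comp (-(C 2 * X) ^ 2) =
        C (c * (-1) ^ n * 2 ^ (p + 2 * n)) * X ^ (p + 2 * n) := by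
      rw [monomial_comp, neg_pow, ← pow_mul, C_mul, C_mul, C_pow, C_pow, mul_pow, mul_pow, C_neg,
        C_1]
      ring
    have h2 : (X : ℚ[X]) ^ p * (monomial n c).comp (X ^ 2) = C c * X ^ (p + 2 * n) := by
      rw [monomial_comp]
      ring
    obtain ⟨r, rfl⟩ := hp
    rw [h1, h2, eulerFunctional, momentFunctional_C_mul_X_pow, momentFunctional_C_mul_X_pow,
      if_pos ⟨r + n, by ring⟩, show (2 * r + 1 + 2 * n) / 2 = r + n by omega,
      show (2 * r + 1) / 2 = r by omega, smul_eq_mul, smul_eq_mul, pow_add (-1 : ℚ) r n]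
    have h3 : ((-1 : ℚ) ^ n) * (-1) ^ n = 1 := by rw [← mul_pow]; simp
    have h4 : (2 : ℚ) ^ (2 * r + 1 + 2 * n) *
        (eulerNumber (2 * r + 1 + 2 * n) / 2 ^ (2 * r + 1 + 2 * n)) =
          eulerNumber (2 * r + 1 + 2 * n) := mul_div_cancel₀ _ (by positivity)
    rw [mul_div_assoc]
    linear_combination (c * (-1 : ℚ) ^ r * (-1) ^ n * (-1) ^ n) * h4 +
      ((-1 : ℚ) ^ r * eulerNumber (2 * r + 1 + 2 * n) * c) * h3

/-- Umbral evaluation in terms of the Euler functional. -/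
theorem eulerFunctional_squarePoly (p : ℕ) (hp : Odd p) :
    eulerFunctional ((C 2 * X) ^ p * ∏ j ∈ Finset.Icc 1 (p - 1),
        (C ((2 * (j : ℚ)) ^ 2) - (C 2 * X) ^ 2) ^ (p - j)) =
      (-1) ^ (p / 2) * umbralEval (squarePoly p) := by
  have h := eulerFunctional_mul_comp p hp
    (∏ j ∈ Finset.Icc 1 (p - 1), (X + C ((2 * (j : ℚ)) ^ 2)) ^ (p - j))
  simp only [prod_comp, pow_comp, add_comp, X_comp, C_comp] at h
  rw [squarePoly, ← h]
  simp only [sub_eq_neg_add]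

/-- With p = 2r+1, the sign from the number of cells is +1, as (p^2-1)/2 is even; row reversal and
the Euler functional each contribute (-1)^r, and these cancel. -/
theorem walkTotal_squareVector (p : ℕ) (hp : Odd p) :
    walkTotal Odd (p ^ 2) (squareVector p) * ∏ i ∈ Finset.range p, ∏ j ∈ Finset.range p,
      ((i : ℚ) + j + 1) = umbralEval (squarePoly p) := by
  have hdet := congrArg eulerFunctional (det_hankel_cayleyCoeff p)
  rw [eulerFunctional_squarePoly p hp, mul_comm _ (C _), ← smul_eq_C_mul, map_smul,
    smul_eq_mul] at hdet
  obtain ⟨r, rfl⟩ := hp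
  have hsq : (2 * r + 1) ^ 2 = 2 * (2 * r * (r + 1)) + 1 := by ring
  have h := walkTotal_eq_eulerFunctional (p := 2 * r + 1) (by omega) (2 * r * (r + 1))
    (strictAnti_squareVector _) (by rw [sum_squareVector, hsq])
  have hsum : ∑ i ∈ Finset.range (2 * r + 1), i = r * (2 * r + 1) := by
    have := Finset.sum_range_id_mul_two (2 * r + 1)
    rw [Nat.add_sub_cancel] at this
    nlinarith
  have hs1 : (-1 : ℚ) ^ (2 * r * (r + 1)) = 1 := by
    rw [mul_assoc, pow_mul]; simp
  have hs2 : (-1 : ℚ) ^ (r * (2 * r + 1)) = (-1) ^ r := by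
    rw [mul_comm, pow_mul, (odd_two_mul_add_one r).neg_one_pow]
  have hs3 : (-1 : ℚ) ^ r * (-1) ^ r = 1 := by rw [← mul_pow]; simp
  rw [jacobiTrudi_squareVector, ← smul_eq_C_mul, map_smul, smul_eq_mul, hsum, hs1, hs2,
    one_mul, ← hsq] at h
  rw [show (2 * r + 1) / 2 = r by omega] at hdet
  rw [h]
  linear_combination (-1 : ℚ) ^ r * hdet + umbralEval (squarePoly (2 * r + 1)) * hs3

end Square

/-! ### Standard tableaux and the row of the largest entry -/

section Standard

variable {μ : YoungDiagram} {T : SemistandardYoungTableau μ}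

theorem IsStandard.pos (hT : IsStandard T) {c : ℕ × ℕ} (hc : c ∈ μ) : 1 ≤ T c.1 c.2 :=
  (hT.mapsTo hc).1

theorem IsStandard.le_card (hT : IsStandard T) {c : ℕ × ℕ} (hc : c ∈ μ) : T c.1 c.2 ≤ μ.card :=
  (hT.mapsTo hc).2

theorem IsStandard.injective (hT : IsStandard T) {c c' : ℕ × ℕ} (hc : c ∈ μ) (hc' : c' ∈ μ)
    (h : T c.1 c.2 = T c'.1 c'.2) : c = c' :=
  hT.injOn hc hc' h

theorem IsStandard.exists_cell (hT : IsStandard T) {k : ℕ} (h1 : 1 ≤ k) (h2 : k ≤ μ.card) :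
    ∃ c ∈ μ, T c.1 c.2 = k :=
  hT.surjOn ⟨h1, h2⟩

/-- `i` is a descent of `T` precisely at the positions `i` with `d i`. -/
def TableauPattern (d : ℕ → Prop) (T : SemistandardYoungTableau μ) : Prop :=
  ∀ i, 1 ≤ i → i < μ.card → (i ∈ descentSet T ↔ d i)

/-- The largest entry of `T` lies in the row `r`; the empty tableau is considered to end in the
row `p - 1`. -/
def EndsIn (p : ℕ) (T : SemistandardYoungTableau μ) (r : ℕ) : Prop :=
  (μ.card = 0 ∧ r + 1 = p) ∨ ∃ c ∈ μ, T c.1 c.2 = μ.card ∧ c.1 = r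

theorem existsUnique_endsIn {p : ℕ} (hp : 0 < p) (hμ : ∀ c ∈ μ, c.1 < p) (hT : IsStandard T) :
    ∃! s : Fin p, s ∈ Finset.univ ∧ EndsIn p T s := by
  rcases Nat.eq_zero_or_pos μ.card with h0 | h0
  · have hempty : ∀ c, c ∉ μ := fun c hc => by
      have := hT.pos hc
      have := hT.le_card hc
      omega
    refine ⟨⟨p - 1, by omega⟩, ⟨Finset.mem_univ _, Or.inl ⟨h0, by simp only; omega⟩⟩, ?_⟩
    rintro s ⟨-, ⟨-, hs⟩ | ⟨c, hc, -⟩⟩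
    · exact Fin.ext (by simp only; omega)
    · exact absurd hc (hempty c)
  · obtain ⟨c, hc, hcard⟩ := hT.exists_cell h0 le_rfl
    refine ⟨⟨c.1, hμ c hc⟩, ⟨Finset.mem_univ _, Or.inr ⟨c, hc, hcard, rfl⟩⟩, ?_⟩
    rintro s ⟨-, ⟨h, -⟩ | ⟨c', hc', hcard', hs⟩⟩
    · omega
    · refine Fin.ext ?_
      rw [← hs, hT.injective hc' hc (hcard'.trans hcard.symm)]

open Classical in
/-- The standard tableaux with descent pattern `d` and the largest entry in the row `r`. -/
noncomputable def standardEndingIn (p : ℕ) (μ : YoungDiagram) (d : ℕ → Prop) (r : ℕ) :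
    Finset (SemistandardYoungTableau μ) :=
  (finite_isStandard μ).toFinset.filter fun T => TableauPattern d T ∧ EndsIn p T r

theorem mem_standardEndingIn {p : ℕ} {d : ℕ → Prop} {r : ℕ} :
    T ∈ standardEndingIn p μ d r ↔ IsStandard T ∧ TableauPattern d T ∧ EndsIn p T r := by
  simp [standardEndingIn]

end Standard

/-! ### Removing and adding a corner -/

section Corner

/-- `k` is a cell of `μ` with no cell of `μ` to the right of it or below it. -/
def IsCorner (μ : YoungDiagram) (k : ℕ × ℕ) : Prop :=
  k ∈ μ ∧ (k.1 + 1, k.2) ∉ μ ∧ (k.1, k.2 + 1) ∉ μ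

variable {μ : YoungDiagram} {k : ℕ × ℕ}

theorem IsCorner.eq_of_le (hk : IsCorner μ k) {c : ℕ × ℕ} (hc : c ∈ μ) (hle : k ≤ c) : c = k := by
  obtain ⟨h1, h2⟩ := hle
  refine Prod.ext ?_ ?_
  · by_contra h
    exact hk.2.1 (μ.up_left_mem (show k.1 + 1 ≤ c.1 by omega) h2 hc)
  · by_contra h
    exact hk.2.2 (μ.up_left_mem h1 (show k.2 + 1 ≤ c.2 by omega) hc)

/-- Remove a corner from a Young diagram. -/
def removeCorner (μ : YoungDiagram) (k : ℕ × ℕ) (hk : IsCorner μ k) : YoungDiagram where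
  cells := μ.cells.erase k
  isLowerSet := by
    intro c c' hle hc
    rw [Finset.mem_coe, Finset.mem_erase] at hc ⊢
    refine ⟨?_, μ.isLowerSet hle hc.2⟩
    rintro rfl
    exact hc.1 (hk.eq_of_le hc.2 hle)

theorem mem_removeCorner (hk : IsCorner μ k) {c : ℕ × ℕ} :
    c ∈ removeCorner μ k hk ↔ c ≠ k ∧ c ∈ μ :=
  Finset.mem_erase

theorem card_removeCorner (hk : IsCorner μ k) : (removeCorner μ k hk).card + 1 = μ.card :=
  Finset.card_erase_add_one hk.1

theorem rowLen_eq_of_forall {ν : YoungDiagram} {i l : ℕ} (h : ∀ j, (i, j) ∈ ν ↔ j < l) :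
    ν.rowLen i = l := by
  have h1 := h (ν.rowLen i)
  have h2 := h l
  rw [YoungDiagram.mem_iff_lt_rowLen] at h1 h2
  omega

theorem IsCorner.rowLen (hk : IsCorner μ k) : μ.rowLen k.1 = k.2 + 1 := by
  have h1 := YoungDiagram.mem_iff_lt_rowLen.1 hk.1
  have h2 : ¬ k.2 + 1 < μ.rowLen k.1 := fun h => hk.2.2 (YoungDiagram.mem_iff_lt_rowLen.2 h)
  omega

theorem rowLen_removeCorner (hk : IsCorner μ k) (i : ℕ) :
    (removeCorner μ k hk).rowLen i = if i = k.1 then k.2 else μ.rowLen i := by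
  refine rowLen_eq_of_forall fun j => ?_
  rw [mem_removeCorner, YoungDiagram.mem_iff_lt_rowLen]
  split_ifs with h
  · subst h
    rw [hk.rowLen, Ne, Prod.ext_iff]
    simp only [true_and]
    omega
  · exact and_iff_right fun h' => h (congrArg Prod.fst h')

/-- Forget the entry of a corner. -/
def restrictTableau (hk : IsCorner μ k) (T : SemistandardYoungTableau μ) :
    SemistandardYoungTableau (removeCorner μ k hk) where
  entry i j := if (i, j) = k then 0 else T i j
  row_weak' := by
    intro i j₁ j₂ hj hc
    have h₁ := (removeCorner μ k hk).up_left_mem le_rfl hj.le hc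
    rw [if_neg ((mem_removeCorner hk).1 h₁).1, if_neg ((mem_removeCorner hk).1 hc).1]
    exact T.row_weak hj ((mem_removeCorner hk).1 hc).2
  col_strict' := by
    intro i₁ i₂ j hi hc
    have h₁ := (removeCorner μ k hk).up_left_mem hi.le le_rfl hc
    rw [if_neg ((mem_removeCorner hk).1 h₁).1, if_neg ((mem_removeCorner hk).1 hc).1]
    exact T.col_strict hi ((mem_removeCorner hk).1 hc).2
  zeros' := by
    intro i j hc
    split_ifs with h
    · rfl
    · exact T.zeros fun h' => hc ((mem_removeCorner hk).2 ⟨h, h'⟩)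

theorem restrictTableau_apply (hk : IsCorner μ k) (T : SemistandardYoungTableau μ) {c : ℕ × ℕ}
    (hc : c ≠ k) : restrictTableau hk T c.1 c.2 = T c.1 c.2 :=
  if_neg hc

/-- Put the largest entry into a corner. -/
def extendTableau (hk : IsCorner μ k) (T : SemistandardYoungTableau (removeCorner μ k hk))
    (hT : IsStandard T) : SemistandardYoungTableau μ where
  entry i j := if (i, j) = k then μ.card else T i j
  row_weak' := by
    intro i j₁ j₂ hj hc
    have h₁ : (i, j₁) ≠ k := by
      rintro rfl
      have := hk.eq_of_le hc ⟨le_rfl, hj.le⟩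
      simp only [Prod.mk.injEq, true_and] at this
      omega
    rw [if_neg h₁]
    split_ifs with h
    · have := hT.le_card ((mem_removeCorner hk).2 ⟨h₁, μ.up_left_mem le_rfl hj.le hc⟩)
      have := card_removeCorner hk
      simp only at *
      omega
    · exact T.row_weak hj ((mem_removeCorner hk).2 ⟨h, hc⟩)
  col_strict' := by
    intro i₁ i₂ j hi hc
    have h₁ : (i₁, j) ≠ k := by
      rintro rfl
      have := hk.eq_of_le hc ⟨hi.le, le_rfl⟩
      simp only [Prod.mk.injEq, and_true] at this
      omega
    rw [if_neg h₁]
    split_ifs with h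
    · have := hT.le_card ((mem_removeCorner hk).2 ⟨h₁, μ.up_left_mem hi.le le_rfl hc⟩)
      have := card_removeCorner hk
      simp only at *
      omega
    · exact T.col_strict hi ((mem_removeCorner hk).2 ⟨h, hc⟩)
  zeros' := by
    intro i j hc
    have h : (i, j) ≠ k := by
      rintro rfl
      exact hc hk.1
    rw [if_neg h]
    exact T.zeros fun h' => hc ((mem_removeCorner hk).1 h').2

theorem extendTableau_corner (hk : IsCorner μ k)
    (T : SemistandardYoungTableau (removeCorner μ k hk)) (hT : IsStandard T) :
    extendTableau hk T hT k.1 k.2 = μ.card :=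
  if_pos rfl

theorem extendTableau_apply (hk : IsCorner μ k)
    (T : SemistandardYoungTableau (removeCorner μ k hk)) (hT : IsStandard T) {c : ℕ × ℕ}
    (hc : c ≠ k) : extendTableau hk T hT c.1 c.2 = T c.1 c.2 :=
  if_neg hc

theorem restrictTableau_extendTableau (hk : IsCorner μ k)
    (T : SemistandardYoungTableau (removeCorner μ k hk)) (hT : IsStandard T) :
    restrictTableau hk (extendTableau hk T hT) = T := by
  ext i j
  by_cases h : (i, j) = k
  · rw [T.zeros fun h' => ((mem_removeCorner hk).1 h').1 h]
    exact if_pos h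
  · rw [restrictTableau_apply hk _ h (c := (i, j)), extendTableau_apply hk T hT h (c := (i, j))]

/-- A tableau with the value `|μ|` in the corner `k` is standard if and only if its restriction
is. -/
theorem isStandard_restrictTableau_iff (hk : IsCorner μ k) {T : SemistandardYoungTableau μ}
    (hTk : T k.1 k.2 = μ.card) : IsStandard (restrictTableau hk T) ↔ IsStandard T := by
  have hcard := card_removeCorner hk
  constructor
  · intro h
    refine ⟨fun c hc => ?_, fun c hc c' hc' heq => ?_, fun n hn => ?_⟩
    · by_cases hck : c = k
      · simp only [hck, hTk, Set.mem_Icc]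
        omega
      · have hc' := (mem_removeCorner hk).2 ⟨hck, hc⟩
        have h1 := h.pos hc'
        have h2 := h.le_card hc'
        rw [restrictTableau_apply hk T hck] at h1 h2
        simp only [Set.mem_Icc]
        omega
    · have hlt : ∀ c ∈ μ, c ≠ k → T c.1 c.2 < μ.card := by
        intro c hc hck
        have h2 := h.le_card ((mem_removeCorner hk).2 ⟨hck, hc⟩)
        rw [restrictTableau_apply hk T hck] at h2
        omega
      simp only at heq
      by_cases hck : c = k
      · by_cases hck' : c' = k
        · rw [hck, hck']
        · have := hlt c' hc' hck'
          rw [hck, hTk] at heq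
          omega
      · by_cases hck' : c' = k
        · have := hlt c hc hck
          rw [hck', hTk] at heq
          omega
        · refine h.injective ((mem_removeCorner hk).2 ⟨hck, hc⟩)
            ((mem_removeCorner hk).2 ⟨hck', hc'⟩) ?_
          rwa [restrictTableau_apply hk T hck, restrictTableau_apply hk T hck']
    · rcases hn.2.lt_or_eq with hlt | rfl
      · obtain ⟨c, hc, hcn⟩ := h.exists_cell hn.1 (by omega)
        obtain ⟨hck, hc⟩ := (mem_removeCorner hk).1 hc
        rw [restrictTableau_apply hk T hck] at hcn
        exact ⟨c, hc, hcn⟩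
      · exact ⟨k, hk.1, hTk⟩
  · intro h
    refine ⟨fun c hc => ?_, fun c hc c' hc' heq => ?_, fun n hn => ?_⟩
    · obtain ⟨hck, hc⟩ := (mem_removeCorner hk).1 hc
      have h1 := h.pos hc
      have h2 := h.le_card hc
      have h3 : T c.1 c.2 ≠ μ.card := fun h' => hck (h.injective hc hk.1 (h'.trans hTk.symm))
      simp only [restrictTableau_apply hk T hck, Set.mem_Icc]
      omega
    · obtain ⟨hck, hc⟩ := (mem_removeCorner hk).1 hc
      obtain ⟨hck', hc'⟩ := (mem_removeCorner hk).1 hc'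
      simp only [restrictTableau_apply hk T hck, restrictTableau_apply hk T hck'] at heq
      exact h.injective hc hc' heq
    · obtain ⟨hn1, hn2⟩ := hn
      obtain ⟨c, hc, hcn⟩ := h.exists_cell hn1 (by omega)
      have hck : c ≠ k := by
        rintro rfl
        omega
      exact ⟨c, (mem_removeCorner hk).2 ⟨hck, hc⟩, (restrictTableau_apply hk T hck).trans hcn⟩

theorem mem_descentSet {μ : YoungDiagram} {T : SemistandardYoungTableau μ} {i : ℕ} :
    i ∈ descentSet T ↔ ∃ c ∈ μ, ∃ d ∈ μ, T c.1 c.2 = i ∧ T d.1 d.2 = i + 1 ∧ c.1 < d.1 :=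
  Iff.rfl

/-- Removing the largest entry loses only the last potential descent, which compares the row of the
corner with the row of the new largest entry. If nothing remains, that entry is placed in the last
row and `¬ d 0` makes the condition automatic. -/
theorem tableauPattern_iff_restrictTableau (hk : IsCorner μ k) {p : ℕ} (hμ : ∀ c ∈ μ, c.1 < p)
    {d : ℕ → Prop} (hd : ¬ d 0) {T : SemistandardYoungTableau μ} (hT : IsStandard T)
    (hTk : T k.1 k.2 = μ.card) :
    TableauPattern d T ↔ TableauPattern d (restrictTableau hk T) ∧
      ∃ s : Fin p, EndsIn p (restrictTableau hk T) s ∧ ((s : ℕ) < k.1 ↔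
        d (removeCorner μ k hk).card) := by
  have hcard := card_removeCorner hk
  have hT' := (isStandard_restrictTableau_iff hk hTk).2 hT
  have hne : ∀ {c}, c ∈ μ → T c.1 c.2 < μ.card → c ∈ removeCorner μ k hk := by
    intro c hc h
    refine (mem_removeCorner hk).2 ⟨?_, hc⟩
    rintro rfl
    omega
  have hdes : ∀ i, i < (removeCorner μ k hk).card →
      (i ∈ descentSet (restrictTableau hk T) ↔ i ∈ descentSet T) := by
    intro i hi
    rw [mem_descentSet, mem_descentSet]
    constructor
    · rintro ⟨c, hc, e, he, h1, h2, h3⟩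
      obtain ⟨hck, hc⟩ := (mem_removeCorner hk).1 hc
      obtain ⟨hek, he⟩ := (mem_removeCorner hk).1 he
      rw [restrictTableau_apply hk T hck] at h1
      rw [restrictTableau_apply hk T hek] at h2
      exact ⟨c, hc, e, he, h1, h2, h3⟩
    · rintro ⟨c, hc, e, he, h1, h2, h3⟩
      have hc' := hne hc (by omega)
      have he' := hne he (by omega)
      refine ⟨c, hc', e, he', ?_, ?_, h3⟩
      · rwa [restrictTableau_apply hk T ((mem_removeCorner hk).1 hc').1]
      · rwa [restrictTableau_apply hk T ((mem_removeCorner hk).1 he').1]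
  have hlast : ∀ s, EndsIn p (restrictTableau hk T) s →
      (s < k.1 ↔ 1 ≤ (removeCorner μ k hk).card ∧
        (removeCorner μ k hk).card ∈ descentSet T) := by
    rintro s (⟨h0, hs⟩ | ⟨c, hc, hcn, rfl⟩)
    · have := hμ k hk.1
      constructor
      · omega
      · omega
    · have hpos := hT'.pos hc
      obtain ⟨hck, hc'⟩ := (mem_removeCorner hk).1 hc
      rw [restrictTableau_apply hk T hck] at hcn hpos
      rw [mem_descentSet]
      constructor
      · exact fun h => ⟨by omega, c, hc', k, hk.1, hcn, by omega, h⟩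
      · rintro ⟨-, c', hc'', e, he, h1, h2, h3⟩
        rw [hT.injective hc' hc'' (hcn.trans h1.symm),
          ← hT.injective he hk.1 (by omega : T e.1 e.2 = T k.1 k.2)]
        exact h3
  have hlast' : (∃ s : Fin p, EndsIn p (restrictTableau hk T) s ∧ ((s : ℕ) < k.1 ↔
      d (removeCorner μ k hk).card)) ↔ (1 ≤ (removeCorner μ k hk).card →
        ((removeCorner μ k hk).card ∈ descentSet T ↔ d (removeCorner μ k hk).card)) := by
    constructor
    · rintro ⟨s, hs, h⟩ h1
      rw [← h, hlast s hs]
      exact (and_iff_right h1).symm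
    · intro h
      have hp : 0 < p := (Nat.zero_le _).trans_lt (hμ k hk.1)
      obtain ⟨s, ⟨-, hs⟩, -⟩ := existsUnique_endsIn hp
        (fun c hc => hμ c ((mem_removeCorner hk).1 hc).2) hT'
      refine ⟨s, hs, ?_⟩
      rw [hlast s hs]
      rcases Nat.eq_zero_or_pos (removeCorner μ k hk).card with h0 | h0
      · rw [h0]
        exact ⟨fun h => absurd h.1 (by omega), fun h => absurd h hd⟩
      · rw [← h h0]
        exact and_iff_right h0
  rw [hlast']
  constructor
  · intro h
    exact ⟨fun i h1 h2 => (hdes i h2).trans (h i h1 (by omega)), fun h1 => h _ h1 (by omega)⟩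
  · rintro ⟨h, h'⟩ i h1 h2
    rcases (show i ≤ (removeCorner μ k hk).card by omega).lt_or_eq with hi | rfl
    · exact (hdes i hi).symm.trans (h i h1 hi)
    · exact h' h1

theorem isCorner_of_eq_card {T : SemistandardYoungTableau μ} (hT : IsStandard T) (hk : k ∈ μ)
    (hTk : T k.1 k.2 = μ.card) : IsCorner μ k := by
  refine ⟨hk, fun h => ?_, fun h => ?_⟩
  · have h1 := T.col_strict (Nat.lt_add_one k.1) h
    have h2 := hT.le_card h
    simp only at h2
    omega
  · have h1 := T.row_weak (Nat.lt_add_one k.2) h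
    have h2 := hT.le_card h
    have h3 := hT.injective h hk (by simp only at h2 ⊢; omega)
    simpa using congrArg Prod.snd h3

end Corner

/-! ### Counting tableaux by walks -/

section Counting

/-- The vector `λ + δ` of a Young diagram. -/
def shapeVector (p : ℕ) (μ : YoungDiagram) (i : Fin p) : ℕ := μ.rowLen i + stair p i

theorem strictAnti_shapeVector (p : ℕ) (μ : YoungDiagram) : StrictAnti (shapeVector p μ) :=
  fun _ _ h => add_lt_add_of_le_of_lt (μ.rowLen_anti _ _ (Fin.le_def.1 h.le)) (strictAnti_stair p h)

theorem shapeVector_removeCorner {p : ℕ} {μ : YoungDiagram} {k : ℕ × ℕ} (hk : IsCorner μ k)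
    (hkp : k.1 < p) : shapeVector p (removeCorner μ k hk) =
      Function.update (shapeVector p μ) ⟨k.1, hkp⟩ (shapeVector p μ ⟨k.1, hkp⟩ - 1) := by
  ext i
  by_cases h : i = ⟨k.1, hkp⟩
  · subst h
    rw [Function.update_self, shapeVector, shapeVector, rowLen_removeCorner, if_pos rfl, hk.rowLen]
    omega
  · rw [Function.update_of_ne h, shapeVector, shapeVector, rowLen_removeCorner,
      if_neg fun h' => h (Fin.ext h')]

/-- If row `r` ends in a corner, removing it matches the recursion for walks, the tableaux left
being sorted by the row of their largest entry. If it does not, both counts vanish. -/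
theorem card_standardEndingIn (p : ℕ) {d : ℕ → Prop} (hd : ¬ d 0) (n : ℕ) (μ : YoungDiagram)
    (hn : μ.card = n) (hμ : ∀ c ∈ μ, c.1 < p) (r : Fin p) :
    ((standardEndingIn p μ d r).card : ℚ) = walkCount d n (shapeVector p μ) r := by
  classical
  induction n generalizing μ r with
  | zero =>
    have hempty : ∀ c, c ∉ μ := fun c hc => by
      have h : μ.cells = ∅ := Finset.card_eq_zero.1 hn
      exact absurd (h ▸ (YoungDiagram.mem_cells c).2 hc) (Finset.notMem_empty c)
    have hshape : shapeVector p μ = stair p := by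
      ext i
      have h : μ.rowLen i = 0 := rowLen_eq_of_forall fun j => by simp [hempty]
      rw [shapeVector, h, zero_add]
    have hstd : ∀ T : SemistandardYoungTableau μ, IsStandard T := fun T =>
      ⟨fun c hc => absurd hc (hempty c), fun c hc => absurd hc (hempty c), fun i hi => by
        rw [hn] at hi
        exact absurd (hi.1.trans hi.2) (by norm_num)⟩
    have hpat : ∀ T : SemistandardYoungTableau μ, TableauPattern d T := fun T i h1 h2 => by omega
    have huniq : ∀ T T' : SemistandardYoungTableau μ, T = T' := fun T T' => by
      ext i j
      rw [T.zeros (hempty _), T'.zeros (hempty _)]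
    have hend : ∀ T : SemistandardYoungTableau μ, EndsIn p T r ↔ (r : ℕ) + 1 = p := fun T =>
      ⟨fun h => h.elim And.right fun ⟨c, hc, _⟩ => absurd hc (hempty c), fun h => Or.inl ⟨hn, h⟩⟩
    rw [walkCount, hshape]
    split_ifs with h
    · rw [Nat.cast_eq_one, Finset.card_eq_one]
      refine ⟨default, Finset.ext fun T => ?_⟩
      rw [mem_standardEndingIn, Finset.mem_singleton]
      exact ⟨fun _ => huniq _ _, fun _ => ⟨hstd T, hpat T, (hend T).2 h.2⟩⟩
    · rw [Nat.cast_eq_zero, Finset.card_eq_zero]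
      refine Finset.eq_empty_of_forall_notMem fun T hT => h ⟨rfl, ?_⟩
      exact (hend T).1 (mem_standardEndingIn.1 hT).2.2
  | succ n ih =>
    by_cases hcorner : ∃ j, IsCorner μ ((r : ℕ), j)
    · obtain ⟨j, hk⟩ := hcorner
      have hνcard : (removeCorner μ ((r : ℕ), j) hk).card = n := by
        have := card_removeCorner hk
        omega
      set ν := removeCorner μ ((r : ℕ), j) hk with hν
      have hνp : ∀ c ∈ ν, c.1 < p := fun c hc => hμ c ((mem_removeCorner hk).1 hc).2
      have hp : 0 < p := r.pos
      have hpos : 0 < shapeVector p μ r := by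
        have := hk.rowLen
        simp only at this
        rw [shapeVector, this]
        omega
      rw [walkCount, if_pos ⟨strictAnti_shapeVector p μ, hpos⟩]
      have hshape : Function.update (shapeVector p μ) r (shapeVector p μ r - 1) =
          shapeVector p ν := (shapeVector_removeCorner hk r.2).symm
      rw [hshape]
      set F : Finset (SemistandardYoungTableau ν) := (finite_isStandard ν).toFinset.filter
        fun T => TableauPattern d T ∧ ∃ s : Fin p, EndsIn p T s ∧ ((s : ℕ) < r ↔ d n) with hF
      have hmemF : ∀ T, T ∈ F ↔ IsStandard T ∧ TableauPattern d T ∧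
          ∃ s : Fin p, EndsIn p T s ∧ ((s : ℕ) < r ↔ d n) := by
        intro T
        simp [hF]
      have hval : ∀ T ∈ standardEndingIn p μ d r, T (r : ℕ) j = μ.card := by
        intro T hT
        obtain ⟨hstd, -, ⟨h0, -⟩ | ⟨c, hc, hcn, hcr⟩⟩ := mem_standardEndingIn.1 hT
        · omega
        · have hc' := (isCorner_of_eq_card hstd hc hcn).rowLen
          have hk' := hk.rowLen
          simp only at hk'
          rw [hcr, hk'] at hc'
          rw [← hcn, ← hcr, show j = c.2 by omega]
      have hbij : (standardEndingIn p μ d r).card = F.card := by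
        refine Finset.card_bij (fun T _ => restrictTableau hk T) ?_ ?_ ?_
        · intro T hT
          have hTk := hval T hT
          obtain ⟨hstd, hpat, -⟩ := mem_standardEndingIn.1 hT
          have h := (tableauPattern_iff_restrictTableau hk hμ hd hstd hTk).1 hpat
          rw [show (removeCorner μ ((r : ℕ), j) hk).card = n from hνcard] at h
          exact (hmemF _).2 ⟨(isStandard_restrictTableau_iff hk hTk).2 hstd, h⟩
        · intro T hT T' hT' h
          ext a b
          by_cases hab : (a, b) = ((r : ℕ), j)
          · obtain ⟨rfl, rfl⟩ := Prod.mk.inj hab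
            rw [hval T hT, hval T' hT']
          · have := restrictTableau_apply hk T hab
            rw [h, restrictTableau_apply hk T' hab] at this
            exact this.symm
        · intro T hT
          obtain ⟨hstd, hpat, hs⟩ := (hmemF T).1 hT
          have hTk := extendTableau_corner hk T hstd
          have hres := restrictTableau_extendTableau hk T hstd
          have hstd' : IsStandard (extendTableau hk T hstd) := by
            rw [← isStandard_restrictTableau_iff hk hTk, hres]
            exact hstd
          refine ⟨extendTableau hk T hstd, mem_standardEndingIn.2 ⟨hstd', ?_, ?_⟩, hres⟩
          · rw [tableauPattern_iff_restrictTableau hk hμ hd hstd' hTk, hres,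
              show (removeCorner μ ((r : ℕ), j) hk).card = n from hνcard]
            exact ⟨hpat, hs⟩
          · exact Or.inr ⟨_, hk.1, hTk, rfl⟩
      have hfib := sum_sum_filter_of_existsUnique (Finset.univ : Finset (Fin p)) F
        (fun s T => EndsIn p T s)
        (fun T hT => existsUnique_endsIn hp hνp ((hmemF T).1 hT).1) (fun _ => 1)
      rw [hbij, Finset.cast_card, ← hfib]
      refine Finset.sum_congr rfl fun s _ => ?_
      rw [← Finset.cast_card]
      split_ifs with hs
      · rw [← ih ν hνcard hνp s]
        congr 2
        ext T
        rw [Finset.mem_filter, hmemF, mem_standardEndingIn]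
        exact ⟨fun h => ⟨h.1.1, h.1.2.1, h.2⟩, fun h => ⟨⟨h.1, h.2.1, s, h.2.2, hs⟩, h.2.2⟩⟩
      · rw [Nat.cast_eq_zero, Finset.card_eq_zero]
        refine Finset.eq_empty_of_forall_notMem fun T hT => hs ?_
        rw [Finset.mem_filter, hmemF] at hT
        obtain ⟨⟨hstd, -, s', hs', h⟩, hsT⟩ := hT
        rw [(existsUnique_endsIn hp hνp hstd).unique ⟨Finset.mem_univ _, hsT⟩
          ⟨Finset.mem_univ _, hs'⟩]
        exact h
    · have hleft : standardEndingIn p μ d r = ∅ := by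
        refine Finset.eq_empty_of_forall_notMem fun T hT => ?_
        obtain ⟨hstd, -, ⟨h0, -⟩ | ⟨c, hc, hcn, hcr⟩⟩ := mem_standardEndingIn.1 hT
        · omega
        · refine hcorner ⟨c.2, ?_⟩
          rw [← hcr]
          exact isCorner_of_eq_card hstd hc hcn
      -- Without a corner in row `r`, the entries of λ+δ in rows `r` and `r + 1` differ by exactly
      -- one, so lowering the upper one creates a tie; in the bottom row the entry is already 0.
      have hlen : μ.rowLen r = μ.rowLen (r + 1) := by
        refine le_antisymm ?_ (μ.rowLen_anti _ _ (Nat.le_succ _))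
        by_contra h
        refine hcorner ⟨μ.rowLen r - 1, ?_, ?_, ?_⟩ <;>
          simp only [YoungDiagram.mem_iff_lt_rowLen] <;> omega
      rw [hleft, Finset.card_empty, Nat.cast_zero, walkCount]
      split_ifs with h
      · symm
        refine Finset.sum_eq_zero fun s _ => ?_
        rw [walkCount_eq_zero, ite_self]
        intro hanti
        by_cases hr : (r : ℕ) + 1 < p
        · have hlt : r < ⟨(r : ℕ) + 1, hr⟩ := by rw [Fin.lt_def]; simp
          have := hanti hlt
          rw [Function.update_self, Function.update_of_ne hlt.ne', shapeVector, shapeVector, hlen,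
            stair, stair, Fin.val_rev, Fin.val_rev] at this
          simp only at this
          omega
        · have h0 : μ.rowLen (r + 1) = 0 := rowLen_eq_of_forall fun j =>
            ⟨fun hj => by have := hμ _ hj; simp only at this; omega, fun hj => by omega⟩
          have := h.2
          rw [shapeVector, hlen, h0, stair, Fin.val_rev] at this
          omega
      · rfl

theorem descentSet_eq_iff {μ : YoungDiagram} {T : SemistandardYoungTableau μ} (hT : IsStandard T)
    (d : ℕ → Prop) :
    descentSet T = {i | d i} ∩ Set.Icc 1 (μ.card - 1) ↔ TableauPattern d T := by
  constructor
  · intro h i h1 h2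
    rw [h]
    exact ⟨fun h => h.1, fun h => ⟨h, h1, by omega⟩⟩
  · intro h
    ext i
    constructor
    · intro hi
      obtain ⟨c, hc, e, he, h1, h2, -⟩ := mem_descentSet.1 hi
      have h3 := hT.pos hc
      have h4 := hT.le_card he
      exact ⟨(h i (by omega) (by omega)).1 hi, by omega, by omega⟩
    · rintro ⟨hodd, h1, h2⟩
      exact (h i h1 (by omega)).2 hodd

theorem alt_eq_walkTotal {p : ℕ} (hp : 0 < p) (μ : YoungDiagram)
    (hμ : ∀ c ∈ μ, c.1 < p) : (alt μ : ℚ) = walkTotal Odd μ.card (shapeVector p μ) := by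
  classical
  set F := (finite_isStandard μ).toFinset.filter fun T => TableauPattern Odd T with hF
  have hmemF : ∀ T, T ∈ F ↔ IsStandard T ∧ TableauPattern Odd T := fun T => by simp [hF]
  have halt : alt μ = F.card := 
    Nat.subtype_card F fun T => by
      rw [hmemF]
      exact and_congr_right fun hT => (descentSet_eq_iff hT Odd).symm
  have hfib := sum_sum_filter_of_existsUnique (Finset.univ : Finset (Fin p)) F
    (fun s T => EndsIn p T s)
    (fun T hT => existsUnique_endsIn hp hμ ((hmemF T).1 hT).1) (fun _ => 1)
  rw [halt, Finset.cast_card, ← hfib, walkTotal]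
  refine Finset.sum_congr rfl fun s _ => ?_
  rw [← card_standardEndingIn p (by simp) _ μ rfl hμ s, ← Finset.cast_card]
  congr 2
  ext T
  rw [Finset.mem_filter, hmemF, mem_standardEndingIn, and_assoc]

end Counting

/-! ### Transposition and reverse alternating tableaux -/

section Transpose

variable {μ : YoungDiagram}

theorem IsStandard.row_strict {T : SemistandardYoungTableau μ} (hT : IsStandard T) {i j₁ j₂ : ℕ}
    (hj : j₁ < j₂) (hc : (i, j₂) ∈ μ) : T i j₁ < T i j₂ := by
  refine lt_of_le_of_ne (T.row_weak hj hc) fun h => ?_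
  have := hT.injective (μ.up_left_mem le_rfl hj.le hc) hc h
  simp only [Prod.mk.injEq, true_and] at this
  omega

/-- The transpose of a standard tableau. -/
def transposeTableau (T : SemistandardYoungTableau μ) (hT : IsStandard T) :
    SemistandardYoungTableau μ.transpose where
  entry i j := T j i
  row_weak' hj hc := (T.col_strict hj (YoungDiagram.mem_transpose.1 hc)).le
  col_strict' hi hc := hT.row_strict hi (YoungDiagram.mem_transpose.1 hc)
  zeros' hc := T.zeros fun h => hc (YoungDiagram.mem_transpose.2 h)

theorem transposeTableau_apply (T : SemistandardYoungTableau μ) (hT : IsStandard T) (i j : ℕ) :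
    transposeTableau T hT i j = T j i := rfl

theorem card_transpose (μ : YoungDiagram) : μ.transpose.card = μ.card := by
  refine Finset.card_bij (fun c _ => c.swap) (fun c hc => YoungDiagram.mem_transpose.1 hc)
    (fun c _ c' _ h => Prod.swap_injective h) fun c hc => ⟨c.swap, ?_, Prod.swap_swap c⟩
  rw [YoungDiagram.mem_cells, YoungDiagram.mem_transpose, Prod.swap_swap]
  exact hc

theorem isStandard_transposeTableau (T : SemistandardYoungTableau μ) (hT : IsStandard T) :
    IsStandard (transposeTableau T hT) := by
  refine ⟨fun c hc => ?_, fun c hc c' hc' heq => ?_, fun n hn => ?_⟩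
  · rw [card_transpose]
    exact hT.mapsTo (YoungDiagram.mem_transpose.1 hc)
  · exact Prod.swap_injective (hT.injective (YoungDiagram.mem_transpose.1 hc)
      (YoungDiagram.mem_transpose.1 hc') heq)
  · rw [card_transpose] at hn
    obtain ⟨c, hc, hcn⟩ := hT.exists_cell hn.1 hn.2
    exact ⟨c.swap, YoungDiagram.mem_transpose.2 (by rwa [Prod.swap_swap]), hcn⟩

/-- Transposition complements the descent set. -/
theorem tableauPattern_transposeTableau {T : SemistandardYoungTableau μ} (hT : IsStandard T)
    {d : ℕ → Prop} (h : TableauPattern d T) :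
    TableauPattern (fun i => ¬ d i) (transposeTableau T hT) := by
  intro i h1 h2
  rw [card_transpose] at h2
  refine Iff.trans ?_ (not_congr (h i h1 h2))
  rw [mem_descentSet, mem_descentSet]
  constructor
  · rintro ⟨c, hc, e, he, hci, hei, hlt⟩ ⟨c', hc', e', he', hci', hei', hlt'⟩
    rw [YoungDiagram.mem_transpose] at hc he
    rw [transposeTableau_apply] at hci hei
    have h3 := hT.injective hc' hc (hci'.trans hci.symm)
    have h4 := hT.injective he' he (hei'.trans hei.symm)
    subst h3 h4
    simp only [Prod.fst_swap] at hlt'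
    -- If `i + 1` were both strictly below and strictly to the right of `i`, this cell would hold an
    -- entry strictly between them.
    have hmem : (c.2, e.1) ∈ μ := μ.up_left_mem hlt'.le le_rfl he
    have h5 := hT.row_strict hlt hmem
    have h6 := T.col_strict hlt' he
    omega
  · intro hnot
    obtain ⟨c, hc, hci⟩ := hT.exists_cell h1 h2.le
    obtain ⟨e, he, hei⟩ := hT.exists_cell (k := i + 1) (by omega) (by omega)
    refine ⟨c.swap, YoungDiagram.mem_transpose.2 (by rwa [Prod.swap_swap]), e.swap,
      YoungDiagram.mem_transpose.2 (by rwa [Prod.swap_swap]), hci, hei, ?_⟩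
    by_contra hlt
    simp only [Prod.fst_swap] at hlt
    have hle : e.1 ≤ c.1 := by
      by_contra hlt'
      exact hnot ⟨c, hc, e, he, hci, hei, by omega⟩
    have h3 := T.row_weak_of_le (not_lt.1 hlt) (μ.up_left_mem hle le_rfl hc)
    have h4 := T.col_weak hle hc
    omega

/-- An inequality suffices: for a self-conjugate shape it is applied to `Odd` and to `Even`, which
are complementary. -/
theorem card_le_card_transpose (d : ℕ → Prop) :
    Nat.card {T : SemistandardYoungTableau μ // IsStandard T ∧ TableauPattern d T} ≤
      Nat.card {T : SemistandardYoungTableau μ.transpose //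
        IsStandard T ∧ TableauPattern (fun i => ¬ d i) T} := by
  have : Finite {T : SemistandardYoungTableau μ.transpose //
      IsStandard T ∧ TableauPattern (fun i => ¬ d i) T} :=
    Set.Finite.subset (finite_isStandard μ.transpose) fun _ h => h.1
  refine Nat.card_le_card_of_injective
    (fun T => ⟨transposeTableau T.1 T.2.1, isStandard_transposeTableau T.1 T.2.1,
      tableauPattern_transposeTableau T.2.1 T.2.2⟩) fun T T' h => Subtype.ext ?_
  ext i j
  exact congrArg (fun U : SemistandardYoungTableau μ.transpose => U j i) (congrArg Subtype.val h)

theorem alt_eq_ralt_of_transpose_eq (hμ : μ.transpose = μ) : alt μ = ralt μ := by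
  have halt : alt μ = Nat.card {T : SemistandardYoungTableau μ //
      IsStandard T ∧ TableauPattern Odd T} := Nat.card_congr <| Equiv.subtypeEquivRight fun T =>
    and_congr_right fun hT => descentSet_eq_iff hT Odd
  have hralt : ralt μ = Nat.card {T : SemistandardYoungTableau μ //
      IsStandard T ∧ TableauPattern Even T} := Nat.card_congr <| Equiv.subtypeEquivRight fun T =>
    and_congr_right fun hT => descentSet_eq_iff hT Even
  have h1 := card_le_card_transpose (μ := μ) Odd
  have h2 := card_le_card_transpose (μ := μ) Even
  simp only [Nat.not_odd_iff_even, Nat.not_even_iff_odd] at h1 h2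
  rw [hμ] at h1 h2
  rw [halt, hralt]
  exact le_antisymm h1 h2

end Transpose

/-! ### Size, rows and hooks of the square -/

section Square

theorem mem_squareShape {p : ℕ} {c : ℕ × ℕ} : c ∈ squareShape p ↔ c.1 < p ∧ c.2 < p := by
  rw [← YoungDiagram.mem_cells, squareShape, Finset.mem_product, Finset.mem_range,
    Finset.mem_range]

theorem card_squareShape (p : ℕ) : (squareShape p).card = p ^ 2 := by
  rw [YoungDiagram.card, squareShape, Finset.card_product, Finset.card_range, sq]

theorem transpose_squareShape (p : ℕ) : (squareShape p).transpose = squareShape p := by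
  ext c
  rw [YoungDiagram.mem_cells, YoungDiagram.mem_cells, YoungDiagram.mem_transpose, mem_squareShape,
    mem_squareShape]
  exact and_comm

theorem rowLen_squareShape {p i : ℕ} (hi : i < p) : (squareShape p).rowLen i = p :=
  rowLen_eq_of_forall fun j => by rw [mem_squareShape]; exact and_iff_right hi

theorem colLen_squareShape {p j : ℕ} (hj : j < p) : (squareShape p).colLen j = p := by
  rw [← YoungDiagram.rowLen_transpose, transpose_squareShape, rowLen_squareShape hj]

theorem shapeVector_squareShape (p : ℕ) : shapeVector p (squareShape p) = squareVector p := by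
  ext i
  rw [shapeVector, squareVector, rowLen_squareShape i.2]

theorem hookProduct_squareShape (p : ℕ) : (hookProduct (squareShape p) : ℚ) =
    ∏ i ∈ Finset.range p, ∏ j ∈ Finset.range p, ((i : ℚ) + j + 1) := by
  have h : hookProduct (squareShape p) =
      ∏ i ∈ Finset.range p, ∏ j ∈ Finset.range p, ((p - 1 - i) + (p - 1 - j) + 1) := by
    rw [hookProduct, show (squareShape p).cells = Finset.range p ×ˢ Finset.range p from rfl,
      Finset.prod_product]
    refine Finset.prod_congr rfl fun i hi => Finset.prod_congr rfl fun j hj => ?_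
    rw [Finset.mem_range] at hi hj
    rw [hookLength, rowLen_squareShape hi, colLen_squareShape hj]
    simp only
    omega
  -- Reflecting both coordinates turns arm plus leg into `i + j`.
  rw [h, Finset.prod_range_reflect
    (fun i => ∏ j ∈ Finset.range p, (i + (p - 1 - j) + 1)) p]
  push_cast
  refine Finset.prod_congr rfl fun i _ => ?_
  have h2 := Finset.prod_range_reflect (fun j : ℕ => (i : ℚ) + j + 1) p
  rw [← h2]

end Square

end AltTableaux

theorem mainTheorem5 (p : ℕ) (hp : Odd p) :
    AltTableaux.alt (AltTableaux.squareShape p) = AltTableaux.ralt (AltTableaux.squareShape p) ∧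
      (AltTableaux.alt (AltTableaux.squareShape p) : ℚ) =
        AltTableaux.umbralEval (AltTableaux.squarePoly p) /
          (AltTableaux.hookProduct (AltTableaux.squareShape p) : ℚ) := by
  refine ⟨AltTableaux.alt_eq_ralt_of_transpose_eq (AltTableaux.transpose_squareShape p), ?_⟩
  have hne : ∏ i ∈ Finset.range p, ∏ j ∈ Finset.range p, ((i : ℚ) + j + 1) ≠ 0 :=
    Finset.prod_ne_zero_iff.2 fun i _ => Finset.prod_ne_zero_iff.2 fun j _ => by positivity
  rw [AltTableaux.hookProduct_squareShape, eq_div_iff hne,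
    ← AltTableaux.walkTotal_squareVector p hp,
    AltTableaux.alt_eq_walkTotal hp.pos _
      fun c hc => (AltTableaux.mem_squareShape.1 hc).1,
    AltTableaux.card_squareShape, AltTableaux.shapeVector_squareShape]
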